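/- Let $m\ge 1$ agents have differentiable local objectives $F_1,\dots,F_m:\mathbb R^d\to\mathbb R$, let $F:=\frac1m\sum_{i=1}^m F_i$, and let $F_{\inf}$ be a lower bound on $F$. Let $g(x;\xi_i)$, where $\xi_i$ has law $\mathcal D_i$, be a measurable stochastic gradient with finite second moments and $\mathbb E[g(x;\xi_i)]=\nabla F_i(x)$. Let $l,\widehat\sigma,\widehat\zeta,M_1,M_2\ge 0$ be constants such that 1. $\|\nabla F_i(x)-\nabla F_i(x')\|\le l\|x-x'\|$ for all $i,x,x'$; 2. $\frac1m\sum_i\mathbb E\|g(x_i;\xi_i)-\nabla F_i(x_i)\|^2\le\widehat\sigma^2+\frac{M_1}{m}\sum_i\|\nabla F(x_i)\|^2$ for all $x_1,\dots,x_m\in\mathbb R^d$; 3. $\frac1m\sum_i\|\nabla F_i(x)\|^2\le\widehat\zeta^2+M_2\|\nabla F(x)\|^2$ for all $x\in\mathbb R^d$. D-PSGD with learning rate $\eta>0$ starts with $x_i^{(1)}=x^{(1)}$ for every agent $i$ and iterates $$x_i^{(k+1)}=\sum_{j=1}^m W_{ij}^{(k)}x_j^{(k)}-\eta\,g(x_i^{(k)};\xi_i^{(k)}),\qquad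 \overline x^{(k)}:=\frac1m\sum_{i=1}^m x_i^{(k)},$$ where $\xi_i^{(k)}$ has law $\mathcal D_i$, the $m\times m$ mixing matrices $W^{(k)}$ are i.i.d. copies of a random matrix $W$ that is almost surely symmetric with each row and column summing to one, and all $W^{(k)},\xi_i^{(k)}$ are mutually independent. Let $J:=\frac1m\mathbf 1\mathbf 1^\top$, let $\|\cdot\|$ denote the spectral norm for matrices, let $\epsilon_0>0$, and for $p\in(0,1]$ let $$K(p,1):=l\,(F(x^{(1)})-F_{\inf})\cdot C\left(\frac{\widehat\sigma^2}{m\epsilon_0^2}+\frac{\widehat\zeta\sqrt{M_1+1}+\widehat\sigma\sqrt p}{p\,\epsilon_0^{3/2}}+\frac{\sqrt{(M_2+1)(M_1+1)}}{p\,\epsilon_0}\right).$$ **Claim.** For every $M_1\ge0$ there is a constant $C>0$, depending on $M_1$ only, such that the following holds for all data as above. (a) If $\mathbb E\|W-J\|^2<1$, then there is $\eta>0$ such that D-PSGD with learning rate $\eta$ satisfies $\frac1K\sum_{k=1}^K\mathbb E\|\nabla F(\overline x^{(k)})\|^2\le\epsilon_0$ (with finite expectations) for every number of iterations $K\ge K(1-\mathbb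 E\|W-J\|^2,1)$. (b) Let $\widetilde E$ be the edge set of a simple undirected graph on $\{1,\dots,m\}$, $B$ its incidence matrix under an arbitrary orientation, and $E_a\subseteq\widetilde E$. Let $\rho^*$ be the optimal value of the semidefinite program of minimizing $\rho$ over $\alpha\in\mathbb R^{\widetilde E}$ and $\rho\in\mathbb R$ subject to $$-\rho I\preceq I-B\,\mathrm{diag}(\alpha)B^\top-J\preceq\rho I,\qquad \alpha_e=0\ \text{ for all } e\notin E_a .$$ A matrix $W$ activates the link $\{i,j\}$, $i\ne j$, if $W_{ij}\neq0$ or $W_{ji}\neq 0$. Let $A$ be an event of positive probability, determined by $W$, on which $W$ activates only links in $E_a$ (for example the event that the set of activated links is exactly $E_a$). If $\mathbb E[\|W-J\|^2\mid A]<1$, then $$K\big(1-\mathbb E[\|W-J\|^2\mid A],1\big)\ \ge\ K\big(1-{\rho^*}^2,1\big).$$ (c) The optimal value $\rho^*$ in (b) is attained. For every optimal $\alpha^*$, the deterministic matrix $W^*:=I-B\,\mathrm{diag}(\alpha^*)B^\top$ is symmetric with each row and column summing to one, activates only links in $E_a$, and attains equality: $K(1-\|W^*-J\|^2,1)=K(1-{\rho^*}^2,1)$,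 both sides being given by the displayed formula. -/

import Mathlib

open MeasureTheory ProbabilityTheory
open scoped Matrix

noncomputable section

namespace DPSGD

/-- The parameter space `ℝ^d` with the Euclidean norm. -/
abbrev Vec (d : ℕ) : Type := EuclideanSpace ℝ (Fin d)

/-- Real `m × m` matrices. -/
abbrev Mat (m : ℕ) : Type := Matrix (Fin m) (Fin m) ℝ

/-- Entrywise (i.e. product) measurable structure, the Borel one. -/
instance instMeasurableSpaceMat (m : ℕ) : MeasurableSpace (Mat m) :=
  inferInstanceAs (MeasurableSpace (Fin m → Fin m → ℝ))

/-- The global objective `F(x) = (1/m) ∑ i, F i x`. -/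
def globalObj {m d : ℕ} (F : Fin m → Vec d → ℝ) (x : Vec d) : ℝ :=
  (1 / (m : ℝ)) * ∑ i, F i x

/-- The average `(1/m) ∑ i, x i` of the agents' parameter vectors. -/
def average {m d : ℕ} (x : Fin m → Vec d) : Vec d :=
  (1 / (m : ℝ)) • ∑ i, x i

/-- D-PSGD along one realization of the mixing matrices `W k` and the mini-batches `ξ k i`,
started with every agent at `x₁`. Iterations are counted from `0`: `iterates … k i` is the
parameter vector of agent `i` after `k` iterations. -/
def iterates {m d : ℕ} {Ξ : Type*} (η : ℝ) (g : Vec d → Ξ → Vec d) (x₁ : Vec d)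
    (W : ℕ → Mat m) (ξ : ℕ → Fin m → Ξ) : ℕ → Fin m → Vec d
  | 0 => fun _ => x₁
  | k + 1 => fun i =>
      (∑ j, W k i j • iterates η g x₁ W ξ k j) - η • g (iterates η g x₁ W ξ k i) (ξ k i)

/-- Each local objective is differentiable with an `l`-Lipschitz gradient. -/
def Smooth {m d : ℕ} (F : Fin m → Vec d → ℝ) (l : ℝ) : Prop :=
  ∀ i, Differentiable ℝ (F i) ∧
    ∀ x y, ‖gradient (F i) x - gradient (F i) y‖ ≤ l * ‖x - y‖

/-- `g(·; ξ)` with `ξ` of law `D i` is a stochastic gradient of `F i`: it is measurable, has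
finite second moments and is unbiased. -/
structure IsStochasticGradient {m d : ℕ} {Ξ : Type*} [MeasurableSpace Ξ]
    (F : Fin m → Vec d → ℝ) (g : Vec d → Ξ → Vec d) (D : Fin m → Measure Ξ) : Prop where
  measurable : Measurable (Function.uncurry g)
  memLp : ∀ i x, MemLp (g x) 2 (D i)
  unbiased : ∀ i x, ∫ s, g x s ∂(D i) = gradient (F i) x

/-- The bound on the noise of the stochastic gradients, with constants `σ` and `M₁`. -/
def NoiseBound {m d : ℕ} {Ξ : Type*} [MeasurableSpace Ξ]
    (F : Fin m → Vec d → ℝ) (g : Vec d → Ξ → Vec d) (D : Fin m → Measure Ξ)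
    (σ M₁ : ℝ) : Prop :=
  ∀ x : Fin m → Vec d,
    (1 / (m : ℝ)) * ∑ i, ∫ s, ‖g (x i) s - gradient (F i) (x i)‖ ^ 2 ∂(D i)
      ≤ σ ^ 2 + M₁ / (m : ℝ) * ∑ i, ‖gradient (globalObj F) (x i)‖ ^ 2

/-- The bound on the heterogeneity of the local objectives, with constants `ζ` and `M₂`. -/
def HeterogeneityBound {m d : ℕ} (F : Fin m → Vec d → ℝ) (ζ M₂ : ℝ) : Prop :=
  ∀ x : Vec d,
    (1 / (m : ℝ)) * ∑ i, ‖gradient (F i) x‖ ^ 2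
      ≤ ζ ^ 2 + M₂ * ‖gradient (globalObj F) x‖ ^ 2

/-- The ideal mixing matrix, with all entries equal to `1/m`. -/
def J (m : ℕ) : Mat m := Matrix.of fun _ _ => 1 / (m : ℝ)

/-- The spectral norm, i.e. the operator norm for the Euclidean norm. -/
def specNorm {m : ℕ} (A : Mat m) : ℝ := ‖Matrix.toEuclideanCLM (n := Fin m) (𝕜 := ℝ) A‖

/-- Symmetric with every row and every column summing to one. -/
def IsMixing {m : ℕ} (w : Mat m) : Prop :=
  w.IsSymm ∧ (∀ i, ∑ j, w i j = 1) ∧ (∀ j, ∑ i, w i j = 1)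

/-- `E[‖W - J‖²]` for a random matrix `W` of law `ν`. -/
def meanSqDist {m : ℕ} (ν : Measure (Mat m)) : ℝ := ∫ w, specNorm (w - J m) ^ 2 ∂ν

/-- `‖W - J‖²` has a finite expectation for a random matrix `W` of law `ν`. -/
def FiniteMeanSqDist {m : ℕ} (ν : Measure (Mat m)) : Prop :=
  Integrable (fun w => specNorm (w - J m) ^ 2) ν

/-- The mixing matrices `W k` are i.i.d. of law `ν`, the mini-batch `ξ k i` of agent `i` has law
`D i` in every iteration `k`, and all these random variables are mutually independent (over the
iterations, and within an iteration over the mixing matrix and the agents). -/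
structure IsSampling {m : ℕ} {Ξ Ω : Type*} [MeasurableSpace Ξ] [MeasurableSpace Ω]
    (P : Measure Ω) (ν : Measure (Mat m)) (D : Fin m → Measure Ξ)
    (W : ℕ → Ω → Mat m) (ξ : ℕ → Fin m → Ω → Ξ) : Prop where
  measurable_mixing : ∀ k, Measurable (W k)
  measurable_batch : ∀ k i, Measurable (ξ k i)
  law_mixing : ∀ k, P.map (W k) = ν
  law_batch : ∀ k i, P.map (ξ k i) = D i
  indep_iterations : iIndepFun (fun k ω => (W k ω, fun i => ξ k i ω)) P
  indep_mixing_batch : ∀ k, IndepFun (W k) (fun ω i => ξ k i ω) P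
  indep_agents : ∀ k, iIndepFun (fun i => ξ k i) P

/-- The number of iterations `K(p, t)`, where `C` is the constant hidden in its `O(·)` and
`Δ = F(x₁) - F_inf` is the initial optimality gap. -/
def K (C l Δ σ ζ M₁ M₂ : ℝ) (m : ℕ) (ε p t : ℝ) : ℝ :=
  l * Δ * (C *
    (σ ^ 2 / ((m : ℝ) * ε ^ 2)
      + (ζ * t * √(M₁ + 1) + σ * √(p * t)) / (p * ε ^ (3 / 2 : ℝ))
      + t * √((M₂ + 1) * (M₁ + 1)) / (p * ε)))

/-- `(1/N) ∑_{k=1}^N E[‖∇F(x̄^(k))‖²] ≤ ε` for D-PSGD with learning rate `η` (the expectations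
being finite); `k` is shifted by one since `iterates` starts at `0`. -/
def Converges {m d : ℕ} {Ξ Ω : Type*} [MeasurableSpace Ω] (P : Measure Ω)
    (F : Fin m → Vec d → ℝ) (g : Vec d → Ξ → Vec d) (x₁ : Vec d)
    (W : ℕ → Ω → Mat m) (ξ : ℕ → Fin m → Ω → Ξ) (η ε : ℝ) (N : ℕ) : Prop :=
  let sqGrad : ℕ → Ω → ℝ := fun k ω =>
    ‖gradient (globalObj F)
      (average (iterates η g x₁ (fun n => W n ω) (fun n i => ξ n i ω) k))‖ ^ 2
  (∀ k ∈ Finset.range N, Integrable (sqGrad k) P) ∧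
    (1 / (N : ℝ)) * ∑ k ∈ Finset.range N, ∫ ω, sqGrad k ω ∂P ≤ ε

/-- The undirected links activated by a mixing matrix: those with a nonzero weight. -/
def activatedLinks {m : ℕ} (w : Mat m) : Set (Sym2 (Fin m)) :=
  {e | ∃ i j, i ≠ j ∧ w i j ≠ 0 ∧ e = s(i, j)}

section LinkWeights

variable {m : ℕ} {G : SimpleGraph (Fin m)} [DecidableRel G.Adj]

/-- The link `e` starts from `src e` and ends at `dst e`. -/
def IsOrientation (src dst : G.edgeSet → Fin m) : Prop :=
  ∀ e : G.edgeSet, s(src e, dst e) = (e : Sym2 (Fin m))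

/-- The incidence matrix `B` of the oriented graph. -/
def incidence (src dst : G.edgeSet → Fin m) : Matrix (Fin m) G.edgeSet ℝ :=
  Matrix.of fun i e => if i = src e then 1 else if i = dst e then -1 else 0

/-- The mixing matrix `I - B diag(α) Bᵀ` with link weights `α`. -/
def mixingOf (src dst : G.edgeSet → Fin m) (α : G.edgeSet → ℝ) : Mat m :=
  1 - incidence src dst * Matrix.diagonal α * (incidence src dst)ᵀ

/-- `(α, ρ)` is feasible: `-ρ I ⪯ I - B diag(α) Bᵀ - J ⪯ ρ I`, and `α` vanishes on the links
outside `Ea`. -/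
def SDPFeasible (src dst : G.edgeSet → Fin m) (Ea : Set (Sym2 (Fin m)))
    (α : G.edgeSet → ℝ) (ρ : ℝ) : Prop :=
  (mixingOf src dst α - J m - (-(ρ • (1 : Mat m)))).PosSemidef ∧
  (ρ • (1 : Mat m) - (mixingOf src dst α - J m)).PosSemidef ∧
  ∀ e : G.edgeSet, (e : Sym2 (Fin m)) ∉ Ea → α e = 0

/-- The optimal value `ρ*` of the semidefinite program of minimizing `ρ`. -/
def sdpValue (src dst : G.edgeSet → Fin m) (Ea : Set (Sym2 (Fin m))) : ℝ :=
  sInf {ρ | ∃ α, SDPFeasible src dst Ea α ρ}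

end LinkWeights

end DPSGD

end

/-! Convergence (a) couples two one-step inequalities. Write `p` for 1 - E‖W - J‖², e_k for the
expected squared gradient at the average, v_k for the expected consensus distance (`dispersion`).
Mixing preserves the average, so smoothness gives descent of the objective by η/4·e_k up to η·l²·v_k
and a noise term of order l·η²·σ²/m (`IsModel.globalObj_step_le`). Mixing contracts deviations from
the average by ‖W - J‖, so v_k contracts by 1 - p/4 up to forcing of order η² in ζ²/p, σ² and (M₂/p
+ M₁)·e_k (`IsModel.dispersion_step_le`). Both are proved from a fixed point and pass to
expectations because the k-th iterate depends on earlier randomness only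
(`IsModel.integral_process_succ_le`).

Summation over k bounds Σ v_k by Σ e_k; a small step size absorbs that part into the descent
(`IsModel.sum_sqGrad_le`). The step size is 1/l over a multiple of `inverseStep`, whose summands are
those of `K` times ε, so each summand enforces one smallness condition (`step_conditions`).

For (b) and (c), the symmetric matrices with unit row sums that activate only links in E_a are
exactly the I - B diag(α) Bᵀ with α supported on E_a, and the semidefinite constraints say that ‖I -
B diag(α) Bᵀ - J‖ ≤ ρ. Hence ρ* is the least distance to J among such matrices. Almost surely on A,
‖W - J‖ ≥ ρ*; squaring, averaging and monotonicity of `K` in `p` give (b). Weights are matrix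
entries, so sublevel sets of the norm are compact and the minimum is attained, which gives (c). -/

namespace DPSGD

/-! ### Spectral norm and quadratic forms. -/

section SpectralNorm

variable {m : ℕ}

lemma specNorm_nonneg (A : Mat m) : 0 ≤ specNorm A := norm_nonneg _

lemma continuous_specNorm : Continuous (specNorm : Mat m → ℝ) := by
  have h : Continuous fun A : Mat m =>
      ((Matrix.toEuclideanCLM (n := Fin m) (𝕜 := ℝ)).toAlgEquiv.toLinearEquiv.toLinearMap) A :=
    LinearMap.continuous_of_finiteDimensional _
  exact h.norm

lemma isSymmetric_toEuclideanCLM {A : Mat m} (hA : A.IsSymm) :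
    (Matrix.toEuclideanCLM (n := Fin m) (𝕜 := ℝ) A : Vec m →ₗ[ℝ] Vec m).IsSymmetric := by
  have : A.IsHermitian := by
    rwa [Matrix.IsHermitian, Matrix.conjTranspose_eq_transpose_of_trivial]
  exact Matrix.isSymmetric_toEuclideanLin_iff.mpr this

lemma norm_sq_toLp (x : Fin m → ℝ) : ‖(WithLp.toLp 2 x : Vec m)‖ ^ 2 = x ⬝ᵥ x := by
  rw [EuclideanSpace.norm_sq_eq]
  simp [dotProduct, pow_two]

/-- The quadratic form of a matrix is bounded by its spectral norm. -/
lemma abs_dotProduct_mulVec_le (A : Mat m) (x : Fin m → ℝ) :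
    |x ⬝ᵥ A *ᵥ x| ≤ specNorm A * (x ⬝ᵥ x) := by
  set y : Vec m := WithLp.toLp 2 x
  have h := Matrix.inner_toEuclideanCLM A y y
  have h1 : |inner ℝ y (Matrix.toEuclideanCLM (n := Fin m) (𝕜 := ℝ) A y)|
      ≤ ‖y‖ * (specNorm A * ‖y‖) :=
    (abs_real_inner_le_norm _ _).trans
      (mul_le_mul_of_nonneg_left (ContinuousLinearMap.le_opNorm _ _) (norm_nonneg _))
  rw [h] at h1
  calc _ ≤ _ := h1
    _ = specNorm A * ‖y‖ ^ 2 := by ring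
    _ = _ := by rw [norm_sq_toLp]

/-- The spectral norm of a symmetric matrix is controlled by its quadratic form. -/
lemma specNorm_le_of_abs_dotProduct_le {A : Mat m} (hA : A.IsSymm) {ρ : ℝ} (hρ : 0 ≤ ρ)
    (h : ∀ x : Fin m → ℝ, |x ⬝ᵥ A *ᵥ x| ≤ ρ * (x ⬝ᵥ x)) : specNorm A ≤ ρ := by
  -- For a symmetric operator the norm is the supremum of the absolute Rayleigh quotients.
  rw [specNorm, ContinuousLinearMap.norm_eq_iSup_rayleighQuotient _
    (isSymmetric_toEuclideanCLM hA)]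
  refine ciSup_le fun y => ?_
  rw [ContinuousLinearMap.rayleighQuotient, ContinuousLinearMap.reApplyInnerSelf_apply, abs_div,
    abs_of_nonneg (sq_nonneg ‖y‖)]
  -- At `y = 0` the quotient is 0/0 = 0, which is where `0 ≤ ρ` enters.
  refine div_le_of_le_mul₀ (sq_nonneg _) hρ ?_
  have h1 := h y.ofLp
  rw [← norm_sq_toLp] at h1
  rw [real_inner_comm, Matrix.inner_toEuclideanCLM]
  exact h1

lemma specNorm_le_iff [NeZero m] {A : Mat m} (hA : A.IsSymm) {ρ : ℝ} :
    specNorm A ≤ ρ ↔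
      (A - -(ρ • (1 : Mat m))).PosSemidef ∧ (ρ • (1 : Mat m) - A).PosSemidef := by
  have hs : (ρ • (1 : Mat m)).IsSymm := by simp [Matrix.IsSymm]
  have e1 : ∀ x : Fin m → ℝ, x ⬝ᵥ (A - -(ρ • (1 : Mat m))) *ᵥ x
      = x ⬝ᵥ A *ᵥ x + ρ * (x ⬝ᵥ x) := fun x => by
    simp [Matrix.add_mulVec, Matrix.smul_mulVec, dotProduct_add]
  have e2 : ∀ x : Fin m → ℝ, x ⬝ᵥ (ρ • (1 : Mat m) - A) *ᵥ x
      = ρ * (x ⬝ᵥ x) - x ⬝ᵥ A *ᵥ x := fun x => by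
    simp [Matrix.sub_mulVec, Matrix.smul_mulVec, dotProduct_sub]
  constructor
  · intro h
    have key : ∀ x : Fin m → ℝ, |x ⬝ᵥ A *ᵥ x| ≤ ρ * (x ⬝ᵥ x) := fun x =>
      (abs_dotProduct_mulVec_le A x).trans
        (mul_le_mul_of_nonneg_right h (Finset.sum_nonneg fun i _ => mul_self_nonneg (x i)))
    constructor
    · refine Matrix.PosSemidef.of_dotProduct_mulVec_nonneg ?_ fun x => ?_
      · rw [Matrix.IsHermitian, Matrix.conjTranspose_eq_transpose_of_trivial]
        exact hA.sub hs.neg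
      · have := abs_le.mp (key x)
        rw [star_trivial, e1]; linarith
    · refine Matrix.PosSemidef.of_dotProduct_mulVec_nonneg ?_ fun x => ?_
      · rw [Matrix.IsHermitian, Matrix.conjTranspose_eq_transpose_of_trivial]
        exact hs.sub hA
      · have := abs_le.mp (key x)
        rw [star_trivial, e2]; linarith
  · rintro ⟨h1, h2⟩
    have key : ∀ x : Fin m → ℝ, |x ⬝ᵥ A *ᵥ x| ≤ ρ * (x ⬝ᵥ x) := fun x => by
      have a1 := h1.dotProduct_mulVec_nonneg x
      have a2 := h2.dotProduct_mulVec_nonneg x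
      rw [star_trivial, e1] at a1
      rw [star_trivial, e2] at a2
      exact abs_le.mpr ⟨by linarith, by linarith⟩
    refine specNorm_le_of_abs_dotProduct_le hA ?_ key
    -- A basis vector forces `0 ≤ ρ`. For m = 0 the semidefinite conditions hold for every `ρ`, so m
    -- must be positive.
    have h0 := (abs_nonneg _).trans (key (Pi.single 0 1))
    simpa using h0

lemma abs_entry_le_specNorm (A : Mat m) (i j : Fin m) : |A i j| ≤ specNorm A := by
  have h := ContinuousLinearMap.le_opNorm (Matrix.toEuclideanCLM (n := Fin m) (𝕜 := ℝ) A)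
    (EuclideanSpace.single j 1)
  have h2 := PiLp.norm_apply_le (Matrix.toEuclideanCLM (n := Fin m) (𝕜 := ℝ) A
    (EuclideanSpace.single j (1 : ℝ))) i
  have h3 : (Matrix.toEuclideanCLM (n := Fin m) (𝕜 := ℝ) A
      (EuclideanSpace.single j (1 : ℝ))) i = A i j := by
    simp [Matrix.ofLp_toEuclideanCLM]
  rw [h3, Real.norm_eq_abs] at h2
  simpa [specNorm] using h2.trans h

/-- A matrix acts on families of vectors with the norm it has on families of scalars. -/
lemma sum_norm_sq_mix_le {d : ℕ} (A : Mat m) (y : Fin m → Vec d) :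
    ∑ i, ‖∑ j, A i j • y j‖ ^ 2 ≤ specNorm A ^ 2 * ∑ i, ‖y i‖ ^ 2 := by
  simp only [EuclideanSpace.real_norm_sq_eq]
  rw [Finset.sum_comm, Finset.sum_comm (s := Finset.univ (α := Fin m)), Finset.mul_sum]
  -- The matrix acts separately on each of the d coordinates, so the operator bound on ℝ^m applies
  -- for each `c`.
  refine Finset.sum_le_sum fun c _ => ?_
  set z : Vec m := WithLp.toLp 2 fun j => y j c
  have h := ContinuousLinearMap.le_opNorm (Matrix.toEuclideanCLM (n := Fin m) (𝕜 := ℝ) A) z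
  have h2 := pow_le_pow_left₀ (norm_nonneg _) h 2
  rw [mul_pow, EuclideanSpace.real_norm_sq_eq, EuclideanSpace.real_norm_sq_eq] at h2
  refine le_trans (le_of_eq ?_) h2
  refine Finset.sum_congr rfl fun i _ => ?_
  congr 1
  simp [Matrix.mulVec, dotProduct, z]

end SpectralNorm

/-! ### Mixing matrices as weighted Laplacians, and the semidefinite program. -/

section LinkWeights

variable {m : ℕ} {G : SimpleGraph (Fin m)} {src dst : G.edgeSet → Fin m}

lemma IsOrientation.src_ne_dst (h : IsOrientation src dst) (e : G.edgeSet) : src e ≠ dst e := by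
  have h1 := e.2
  rw [← h e, SimpleGraph.mem_edgeSet] at h1
  exact h1.ne

lemma IsOrientation.sum_incidence (h : IsOrientation src dst) (e : G.edgeSet) :
    ∑ i, incidence src dst i e = 0 := by
  have hne := h.src_ne_dst e
  have : ∀ i, incidence src dst i e
      = (if i = src e then (1 : ℝ) else 0) - (if i = dst e then 1 else 0) := by
    intro i
    simp only [incidence, Matrix.of_apply]
    split_ifs <;> grind
  simp [this]

lemma IsOrientation.incidence_mul (h : IsOrientation src dst) (e : G.edgeSet) {i j : Fin m}
    (hij : i ≠ j) : incidence src dst i e * incidence src dst j e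
      = if (e : Sym2 (Fin m)) = s(i, j) then -1 else 0 := by
  have hne := h.src_ne_dst e
  have he : (e : Sym2 (Fin m)) = s(i, j) ↔ src e = i ∧ dst e = j ∨ src e = j ∧ dst e = i := by
    rw [← h e, Sym2.eq_iff]
  simp only [incidence, Matrix.of_apply, he]
  split_ifs <;> grind

variable [DecidableRel G.Adj]

lemma mixingOf_apply (α : G.edgeSet → ℝ) (i j : Fin m) :
    mixingOf src dst α i j = (1 : Mat m) i j
      - ∑ e, α e * (incidence src dst i e * incidence src dst j e) := by
  rw [mixingOf, Matrix.sub_apply, Matrix.mul_apply]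
  congr 1
  refine Finset.sum_congr rfl fun e _ => ?_
  rw [Matrix.mul_diagonal, Matrix.transpose_apply]
  ring

/-- The two signs in the incidence column of a link cancel the minus sign in I - B diag(α) Bᵀ, so
link weights are off-diagonal entries whatever the orientation. -/
lemma IsOrientation.mixingOf_of_adj (h : IsOrientation src dst) (α : G.edgeSet → ℝ) {i j : Fin m}
    (hij : s(i, j) ∈ G.edgeSet) : mixingOf src dst α i j = α ⟨s(i, j), hij⟩ := by
  have hne : i ≠ j := ((SimpleGraph.mem_edgeSet G).mp hij).ne
  rw [mixingOf_apply, Matrix.one_apply_ne hne, Finset.sum_eq_single ⟨s(i, j), hij⟩]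
  · rw [h.incidence_mul _ hne]; simp
  · intro e _ he
    rw [h.incidence_mul _ hne, if_neg fun h' => he (Subtype.ext h'), mul_zero]
  · simp

lemma IsOrientation.mixingOf_of_not_adj (h : IsOrientation src dst) (α : G.edgeSet → ℝ)
    {i j : Fin m} (hne : i ≠ j) (hij : s(i, j) ∉ G.edgeSet) : mixingOf src dst α i j = 0 := by
  rw [mixingOf_apply, Matrix.one_apply_ne hne, Finset.sum_eq_zero, sub_zero]
  intro e _
  have he : (e : Sym2 (Fin m)) ≠ s(i, j) := fun h' => hij (h' ▸ e.2)
  rw [h.incidence_mul _ hne, if_neg he, mul_zero]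

lemma mixingOf_isSymm (α : G.edgeSet → ℝ) : (mixingOf src dst α).IsSymm := by
  refine Matrix.IsSymm.ext fun i j => ?_
  rw [mixingOf_apply, mixingOf_apply]
  congr 1
  · simp [Matrix.one_apply, eq_comm]
  · exact Finset.sum_congr rfl fun e _ => by ring

lemma IsOrientation.isMixing_mixingOf (h : IsOrientation src dst) (α : G.edgeSet → ℝ) :
    IsMixing (mixingOf src dst α) := by
  have hs := mixingOf_isSymm (src := src) (dst := dst) α
  have hcol : ∀ j, ∑ i, mixingOf src dst α i j = 1 := fun j => by
    simp only [mixingOf_apply, Finset.sum_sub_distrib]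
    rw [Finset.sum_comm]
    have : ∀ e, ∑ i, α e * (incidence src dst i e * incidence src dst j e) = 0 := fun e => by
      rw [← Finset.mul_sum, ← Finset.sum_mul, h.sum_incidence, zero_mul, mul_zero]
    simp [this, Matrix.one_apply]
  refine ⟨hs, fun i => ?_, hcol⟩
  rw [← hcol i]
  exact Finset.sum_congr rfl fun j _ => hs.apply j i

/-- A mixing matrix that activates only links of the graph is given by link weights. -/
lemma IsOrientation.exists_mixingOf_eq (h : IsOrientation src dst) {Ea : Set (Sym2 (Fin m))}
    (hEa : Ea ⊆ G.edgeSet) {w : Mat m} (hw : IsMixing w) (hact : activatedLinks w ⊆ Ea) :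
    ∃ α : G.edgeSet → ℝ, mixingOf src dst α = w ∧
      ∀ e : G.edgeSet, (e : Sym2 (Fin m)) ∉ Ea → α e = 0 := by
  have hzero : ∀ i j, i ≠ j → s(i, j) ∉ Ea → w i j = 0 := fun i j hij hnot => by
    by_contra h0
    exact hnot (hact ⟨i, j, hij, h0, rfl⟩)
  set α : G.edgeSet → ℝ := fun e => w (src e) (dst e)
  have hoff : ∀ i j, i ≠ j → mixingOf src dst α i j = w i j := fun i j hij => by
    by_cases he : s(i, j) ∈ G.edgeSet
    · rw [h.mixingOf_of_adj α he]
      have := h ⟨s(i, j), he⟩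
      rw [Sym2.eq_iff] at this
      rcases this with ⟨h1, h2⟩ | ⟨h1, h2⟩
      · simp only [α, h1, h2]
      · simp only [α, h1, h2]; exact hw.1.apply i j
    · rw [h.mixingOf_of_not_adj α hij he, hzero i j hij fun h' => he (hEa h')]
  refine ⟨α, ?_, fun e he => hzero _ _ (h.src_ne_dst e) (by rwa [h e])⟩
  ext i j
  by_cases hij : i = j
  -- The diagonal is determined by the off-diagonal entries, since both matrices have unit row sums.
  · subst hij
    have h1 := (h.isMixing_mixingOf α).2.1 i
    have h2 := hw.2.1 i
    rw [← Finset.add_sum_erase _ _ (Finset.mem_univ i)] at h1 h2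
    have h3 : ∑ j ∈ Finset.univ.erase i, mixingOf src dst α i j
        = ∑ j ∈ Finset.univ.erase i, w i j :=
      Finset.sum_congr rfl fun j hj => hoff i j (Finset.ne_of_mem_erase hj).symm
    linarith
  · exact hoff i j hij

lemma J_isSymm (m : ℕ) : (J m).IsSymm := Matrix.IsSymm.ext fun _ _ => rfl

/-- Turns the program into minimization of a spectral norm over supported weights. -/
lemma sdpFeasible_iff [NeZero m] {Ea : Set (Sym2 (Fin m))} {α : G.edgeSet → ℝ} {ρ : ℝ} :
    SDPFeasible src dst Ea α ρ ↔ specNorm (mixingOf src dst α - J m) ≤ ρ ∧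
      ∀ e : G.edgeSet, (e : Sym2 (Fin m)) ∉ Ea → α e = 0 := by
  rw [specNorm_le_iff ((mixingOf_isSymm α).sub (J_isSymm m)), and_assoc, SDPFeasible]

lemma continuous_mixingOf : Continuous (mixingOf src dst) := by
  refine continuous_matrix fun i j => ?_
  simp only [mixingOf_apply]
  fun_prop

lemma sdpValue_le [NeZero m] {Ea : Set (Sym2 (Fin m))} {α : G.edgeSet → ℝ} {ρ : ℝ}
    (h : SDPFeasible src dst Ea α ρ) : sdpValue src dst Ea ≤ ρ :=
  csInf_le ⟨0, fun _ ⟨_, h'⟩ => (specNorm_nonneg _).trans (sdpFeasible_iff.mp h').1⟩ ⟨α, h⟩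

lemma sdpValue_nonneg [NeZero m] (Ea : Set (Sym2 (Fin m))) : 0 ≤ sdpValue src dst Ea :=
  Real.sInf_nonneg fun _ ⟨_, h'⟩ => (specNorm_nonneg _).trans (sdpFeasible_iff.mp h').1

/-- Coercivity of the objective: a weight is an entry of the mixing matrix, at most 1/m ≤ 1 away
from an entry of its difference with J. -/
lemma IsOrientation.abs_weight_le (h : IsOrientation src dst) (α : G.edgeSet → ℝ)
    (e : G.edgeSet) : |α e| ≤ specNorm (mixingOf src dst α - J m) + 1 := by
  have h1 := abs_entry_le_specNorm (mixingOf src dst α - J m) (src e) (dst e)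
  have h2 : mixingOf src dst α (src e) (dst e) = α e := by
    have he : s(src e, dst e) ∈ G.edgeSet := by rw [h e]; exact e.2
    rw [h.mixingOf_of_adj α he]
    congr 1
    exact Subtype.ext (h e)
  have h3 : |1 / (m : ℝ)| ≤ 1 := by
    rw [abs_of_nonneg (by positivity), one_div]
    exact Nat.cast_inv_le_one m
  rw [Matrix.sub_apply, h2] at h1
  calc |α e| = |(α e - J m (src e) (dst e)) + 1 / (m : ℝ)| := by simp [J]
    _ ≤ _ := (abs_add_le _ _).trans (add_le_add h1 h3)

lemma IsOrientation.exists_sdpFeasible_sdpValue [NeZero m] (h : IsOrientation src dst)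
    (Ea : Set (Sym2 (Fin m))) : ∃ α, SDPFeasible src dst Ea α (sdpValue src dst Ea) := by
  set f : (G.edgeSet → ℝ) → ℝ := fun α => specNorm (mixingOf src dst α - J m)
  have hf : Continuous f := continuous_specNorm.comp (continuous_mixingOf.sub continuous_const)
  -- Restricting to the sublevel set of the feasible point α = 0 makes the domain compact; weights
  -- outside it cannot improve on 0.
  set S : Set (G.edgeSet → ℝ) :=
    {α | (∀ e : G.edgeSet, (e : Sym2 (Fin m)) ∉ Ea → α e = 0) ∧ f α ≤ f 0}
  have hclosed : IsClosed S := by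
    have h0 : {α : G.edgeSet → ℝ | ∀ e : G.edgeSet, (e : Sym2 (Fin m)) ∉ Ea → α e = 0}
        = ⋂ e : G.edgeSet, ⋂ _ : (e : Sym2 (Fin m)) ∉ Ea, {α | α e = 0} := by
      ext; simp
    have h1 : IsClosed
        {α : G.edgeSet → ℝ | ∀ e : G.edgeSet, (e : Sym2 (Fin m)) ∉ Ea → α e = 0} := by
      rw [h0]
      exact isClosed_iInter fun e => isClosed_iInter fun _ =>
        isClosed_eq (continuous_apply e) continuous_const
    exact h1.inter (isClosed_le hf continuous_const)
  have hbdd : Bornology.IsBounded S := by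
    refine (Metric.isBounded_closedBall (x := (0 : G.edgeSet → ℝ)) (r := f 0 + 1)).subset ?_
    intro α hα
    rw [mem_closedBall_zero_iff]
    refine (pi_norm_le_iff_of_nonneg (add_nonneg (specNorm_nonneg _) zero_le_one)).mpr fun e => ?_
    exact (h.abs_weight_le α e).trans (add_le_add hα.2 le_rfl)
  have hcomp : IsCompact S := Metric.isCompact_of_isClosed_isBounded hclosed hbdd
  obtain ⟨α, hα, hmin⟩ := hcomp.exists_isMinOn ⟨0, fun _ _ => rfl, le_rfl⟩ hf.continuousOn
  have hle : ∀ β ρ, SDPFeasible src dst Ea β ρ → f α ≤ ρ := fun β ρ hβ => by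
    obtain ⟨h1, h2⟩ := sdpFeasible_iff.mp hβ
    by_cases h0 : f β ≤ f 0
    · exact (hmin ⟨h2, h0⟩ : f α ≤ f β).trans h1
    · exact hα.2.trans ((not_le.mp h0).le.trans h1)
  refine ⟨α, sdpFeasible_iff.mpr ⟨?_, hα.1⟩⟩
  exact le_csInf ⟨_, α, sdpFeasible_iff.mpr ⟨le_rfl, hα.1⟩⟩ fun ρ ⟨β, hβ⟩ => hle β ρ hβ

/-- The pointwise bound behind (b): such a `w` is itself a candidate of the program. -/
lemma IsOrientation.sdpValue_le_specNorm [NeZero m] (h : IsOrientation src dst)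
    {Ea : Set (Sym2 (Fin m))} (hEa : Ea ⊆ G.edgeSet) {w : Mat m} (hw : IsMixing w)
    (hact : activatedLinks w ⊆ Ea) : sdpValue src dst Ea ≤ specNorm (w - J m) := by
  obtain ⟨α, rfl, hα⟩ := h.exists_mixingOf_eq hEa hw hact
  exact sdpValue_le (sdpFeasible_iff.mpr ⟨le_rfl, hα⟩)

lemma specNorm_eq_sdpValue [NeZero m] {Ea : Set (Sym2 (Fin m))} {α : G.edgeSet → ℝ}
    (hα : SDPFeasible src dst Ea α (sdpValue src dst Ea)) :
    specNorm (mixingOf src dst α - J m) = sdpValue src dst Ea := by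
  obtain ⟨h1, h2⟩ := sdpFeasible_iff.mp hα
  exact h1.antisymm (sdpValue_le (sdpFeasible_iff.mpr ⟨le_rfl, h2⟩))

lemma IsOrientation.activatedLinks_mixingOf_subset (h : IsOrientation src dst)
    {Ea : Set (Sym2 (Fin m))} {α : G.edgeSet → ℝ}
    (hα : ∀ e : G.edgeSet, (e : Sym2 (Fin m)) ∉ Ea → α e = 0) :
    activatedLinks (mixingOf src dst α) ⊆ Ea := by
  rintro _ ⟨i, j, hij, hne, rfl⟩
  by_contra hnot
  refine hne ?_
  by_cases he : s(i, j) ∈ G.edgeSet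
  · rw [h.mixingOf_of_adj α he]; exact hα _ hnot
  · exact h.mixingOf_of_not_adj α hij he

end LinkWeights

/-! ### Mean squared distance to J, and monotonicity of the iteration count. -/

section ExpectedSpectralNorm

variable {m : ℕ}

instance : BorelSpace (Mat m) := inferInstanceAs (BorelSpace (Fin m → Fin m → ℝ))

lemma continuous_sqDist : Continuous fun w : Mat m => specNorm (w - J m) ^ 2 :=
  (continuous_specNorm.comp (continuous_id.sub continuous_const)).pow 2

lemma meanSqDist_nonneg (ν : Measure (Mat m)) : 0 ≤ meanSqDist ν :=
  integral_nonneg fun _ => sq_nonneg _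

lemma meanSqDist_dirac (w : Mat m) : meanSqDist (Measure.dirac w) = specNorm (w - J m) ^ 2 :=
  integral_dirac' _ _ continuous_sqDist.measurable.stronglyMeasurable

lemma sq_le_meanSqDist {ν : Measure (Mat m)} [IsProbabilityMeasure ν]
    (hν : FiniteMeanSqDist ν) {c : ℝ} (hc : 0 ≤ c) (h : ∀ᵐ w ∂ν, c ≤ specNorm (w - J m)) :
    c ^ 2 ≤ meanSqDist ν := by
  have : ∫ _, c ^ 2 ∂ν ≤ meanSqDist ν :=
    integral_mono_ae (integrable_const _) hν (h.mono fun w hw => pow_le_pow_left₀ hc hw 2)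
  simpa using this

/-- The number of iterations decreases with the spectral gap. -/
lemma K_anti {C l Δ σ ζ M₁ M₂ : ℝ} {m : ℕ} {ε p q : ℝ} (hC : 0 ≤ C) (hl : 0 ≤ l) (hΔ : 0 ≤ Δ)
    (hσ : 0 ≤ σ) (hζ : 0 ≤ ζ) (hε : 0 < ε) (hp : 0 < p) (hpq : p ≤ q) :
    K C l Δ σ ζ M₁ M₂ m ε q 1 ≤ K C l Δ σ ζ M₁ M₂ m ε p 1 := by
  have hq : 0 < q := hp.trans_le hpq
  unfold K
  simp only [mul_one, one_mul]
  -- Rewriting √r/r as 1/√r makes each term visibly decreasing in `r`.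
  have h1 : ∀ r : ℝ, 0 < r → (ζ * √(M₁ + 1) + σ * √r) / (r * ε ^ (3 / 2 : ℝ))
      = (ζ * √(M₁ + 1) / r + σ / √r) / ε ^ (3 / 2 : ℝ) := fun r hr => by
    have h2 : √r / r = 1 / √r := by
      rw [Real.sqrt_div_self]
      simp
    rw [← div_div, add_div, mul_div_assoc σ, h2]
    simp [div_eq_mul_inv]
  rw [h1 p hp, h1 q hq]
  gcongr

end ExpectedSpectralNorm

end DPSGD

namespace DPSGD

/-! ### Smooth functions: the descent lemma. -/

section Descent

variable {E : Type*} [NormedAddCommGroup E] [InnerProductSpace ℝ E] [CompleteSpace E]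

/-- The quadratic upper bound for functions with Lipschitz gradient. -/
lemma le_add_of_lipschitz_gradient {f : E → ℝ} {l : ℝ} (hf : Differentiable ℝ f)
    (hl : ∀ x y, ‖gradient f x - gradient f y‖ ≤ l * ‖x - y‖) (x v : E) :
    f (x + v) ≤ f x + inner ℝ (gradient f x) v + l / 2 * ‖v‖ ^ 2 := by
  -- `φ` is `f` on the segment minus its quadratic model; Cauchy–Schwarz and the Lipschitz bound
  -- make its derivative nonpositive on [0, 1], and φ(1) ≤ φ(0) is the claim.
  set φ : ℝ → ℝ := fun t =>
    f (x + t • v) - t * inner ℝ (gradient f x) v - l / 2 * t ^ 2 * ‖v‖ ^ 2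
  have hderiv : ∀ t, HasDerivAt φ (inner ℝ (gradient f (x + t • v) - gradient f x) v
      - l * t * ‖v‖ ^ 2) t := fun t => by
    have h1 : HasDerivAt (fun t : ℝ => x + t • v) v t := by
      simpa using ((hasDerivAt_id t).smul_const v).const_add x
    have h2 : HasDerivAt (fun t : ℝ => f (x + t • v)) (fderiv ℝ f (x + t • v) v) t :=
      (hf (x + t • v)).hasFDerivAt.comp_hasDerivAt t h1
    have h3 := ((h2.sub ((hasDerivAt_id t).mul_const (inner ℝ (gradient f x) v))).sub
      ((((hasDerivAt_id t).pow 2).const_mul (l / 2)).mul_const (‖v‖ ^ 2)))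
    refine h3.congr_deriv ?_
    simp only [inner_sub_left, inner_gradient_left, Nat.cast_ofNat, id_eq, one_mul,
      mul_one, Nat.add_one_sub_one, pow_one]
    ring
  have hanti : AntitoneOn φ (Set.Icc 0 1) := by
    refine antitoneOn_of_deriv_nonpos (convex_Icc 0 1)
      (fun t _ => (hderiv t).continuousAt.continuousWithinAt)
      (fun t _ => (hderiv t).differentiableAt.differentiableWithinAt) fun t ht => ?_
    rw [interior_Icc] at ht
    rw [(hderiv t).deriv]
    have h1 := real_inner_le_norm (gradient f (x + t • v) - gradient f x) v
    have h2 := hl (x + t • v) x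
    rw [add_sub_cancel_left, norm_smul, Real.norm_of_nonneg ht.1.le] at h2
    nlinarith [mul_le_mul_of_nonneg_right h2 (norm_nonneg v)]
  have h := hanti (Set.left_mem_Icc.mpr zero_le_one) (Set.right_mem_Icc.mpr zero_le_one)
    zero_le_one
  simp only [φ, one_smul, zero_smul, add_zero] at h
  linarith

/-- A function with constant gradient that is bounded below has zero gradient. -/
lemma gradient_eq_zero_of_bddBelow {f : E → ℝ} {c : ℝ} (hf : Differentiable ℝ f)
    (hl : ∀ x y, ‖gradient f x - gradient f y‖ ≤ 0 * ‖x - y‖) (hc : ∀ x, c ≤ f x) (x : E) :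
    gradient f x = 0 := by
  by_contra h
  have hpos : 0 < ‖gradient f x‖ ^ 2 := by positivity
  -- The step length for which the linear bound falls to `c - 1`, below the lower bound.
  set t := (f x - c + 1) / ‖gradient f x‖ ^ 2
  have h1 := le_add_of_lipschitz_gradient hf hl x (-(t • gradient f x))
  have h2 := hc (x + -(t • gradient f x))
  rw [inner_neg_right, inner_smul_right, real_inner_self_eq_norm_sq] at h1
  have h3 : t * ‖gradient f x‖ ^ 2 = f x - c + 1 := div_mul_cancel₀ _ hpos.ne'
  rw [h3] at h1
  linarith

end Descent

/-! ### Averages and consensus distance. -/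

section Average

variable {m d : ℕ}

/-- The mean squared norm of a family of vectors. -/
noncomputable def meanSq (x : Fin m → Vec d) : ℝ := (1 / (m : ℝ)) * ∑ i, ‖x i‖ ^ 2

/-- The consensus distance: the mean squared distance to the average. -/
noncomputable def dispersion (x : Fin m → Vec d) : ℝ := meanSq fun i => x i - average x

lemma meanSq_nonneg (x : Fin m → Vec d) : 0 ≤ meanSq x :=
  mul_nonneg (by positivity) (Finset.sum_nonneg fun _ _ => sq_nonneg _)

lemma dispersion_nonneg (x : Fin m → Vec d) : 0 ≤ dispersion x := meanSq_nonneg _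

lemma average_sub (x y : Fin m → Vec d) :
    average (fun i => x i - y i) = average x - average y := by
  simp [average, smul_sub]

lemma average_add (x y : Fin m → Vec d) :
    average (fun i => x i + y i) = average x + average y := by
  simp [average, Finset.sum_add_distrib]

lemma average_smul (c : ℝ) (x : Fin m → Vec d) :
    average (fun i => c • x i) = c • average x := by
  rw [average, average, ← Finset.smul_sum, smul_comm]

lemma average_const [NeZero m] (c : Vec d) : average (fun _ : Fin m => c) = c := by
  have : (m : ℝ) ≠ 0 := Nat.cast_ne_zero.mpr (NeZero.ne m)
  rw [average, Finset.sum_const, Finset.card_univ, Fintype.card_fin, ← Nat.cast_smul_eq_nsmul ℝ,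
    smul_smul, one_div_mul_cancel this, one_smul]

lemma sum_eq_smul_average [NeZero m] (x : Fin m → Vec d) : ∑ i, x i = (m : ℝ) • average x := by
  have : (m : ℝ) ≠ 0 := Nat.cast_ne_zero.mpr (NeZero.ne m)
  rw [average, smul_smul, mul_one_div_cancel this, one_smul]

lemma dispersion_const [NeZero m] (c : Vec d) : dispersion (fun _ : Fin m => c) = 0 := by
  simp [dispersion, meanSq, average_const]

/-- The bias-variance decomposition. -/
lemma dispersion_eq [NeZero m] (x : Fin m → Vec d) :
    dispersion x = meanSq x - ‖average x‖ ^ 2 := by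
  have hm : (m : ℝ) ≠ 0 := Nat.cast_ne_zero.mpr (NeZero.ne m)
  simp only [dispersion, meanSq, norm_sub_sq_real, Finset.sum_add_distrib, Finset.sum_sub_distrib]
  rw [← Finset.mul_sum, ← sum_inner, sum_eq_smul_average, inner_smul_left,
    real_inner_self_eq_norm_sq]
  simp
  field_simp
  ring

lemma dispersion_le_meanSq [NeZero m] (x : Fin m → Vec d) : dispersion x ≤ meanSq x := by
  rw [dispersion_eq]; linarith [sq_nonneg ‖average x‖]

lemma norm_average_sq_le [NeZero m] (x : Fin m → Vec d) : ‖average x‖ ^ 2 ≤ meanSq x := by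
  linarith [dispersion_eq x, dispersion_nonneg x]

lemma meanSq_le_of_le {x y : Fin m → Vec d} {c : ℝ}
    (h : ∀ i, ‖x i‖ ≤ c * ‖y i‖) : meanSq x ≤ c ^ 2 * meanSq y := by
  rw [meanSq, meanSq, mul_left_comm, Finset.mul_sum (a := c ^ 2)]
  refine mul_le_mul_of_nonneg_left (Finset.sum_le_sum fun i _ => ?_) (by positivity)
  rw [← mul_pow]
  exact pow_le_pow_left₀ (norm_nonneg _) (h i) 2

/-- Young's inequality with a free parameter: a small `τ` hardly inflates the first term, so a
contraction there survives. -/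
lemma norm_sub_sq_le {E : Type*} [NormedAddCommGroup E] [InnerProductSpace ℝ E] {τ : ℝ}
    (hτ : 0 < τ) (a b : E) : ‖a - b‖ ^ 2 ≤ (1 + τ) * ‖a‖ ^ 2 + (1 + 1 / τ) * ‖b‖ ^ 2 := by
  have h1 := norm_sub_le a b
  have h2 : ‖a - b‖ ^ 2 ≤ (‖a‖ + ‖b‖) ^ 2 := pow_le_pow_left₀ (norm_nonneg _) h1 2
  have h3 : 2 * (‖a‖ * ‖b‖) ≤ τ * ‖a‖ ^ 2 + 1 / τ * ‖b‖ ^ 2 := by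
    have h4 : τ * ‖a‖ ^ 2 + 1 / τ * ‖b‖ ^ 2 - 2 * (‖a‖ * ‖b‖) = 1 / τ * (τ * ‖a‖ - ‖b‖) ^ 2 := by
      field_simp
      ring
    have h5 : 0 ≤ 1 / τ * (τ * ‖a‖ - ‖b‖) ^ 2 := by positivity
    linarith
  linarith

lemma meanSq_sub_le {τ : ℝ} (hτ : 0 < τ) (a b : Fin m → Vec d) :
    meanSq (fun i => a i - b i) ≤ (1 + τ) * meanSq a + (1 + 1 / τ) * meanSq b := by
  have : (1 + τ) * meanSq a + (1 + 1 / τ) * meanSq b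
      = 1 / (m : ℝ) * ∑ i, ((1 + τ) * ‖a i‖ ^ 2 + (1 + 1 / τ) * ‖b i‖ ^ 2) := by
    rw [Finset.sum_add_distrib, ← Finset.mul_sum, ← Finset.mul_sum, meanSq, meanSq]
    ring
  rw [this, meanSq]
  exact mul_le_mul_of_nonneg_left (Finset.sum_le_sum fun i _ => norm_sub_sq_le hτ _ _)
    (by positivity)

lemma dispersion_sub_le {τ : ℝ} (hτ : 0 < τ) (a b : Fin m → Vec d) :
    dispersion (fun i => a i - b i) ≤ (1 + τ) * dispersion a + (1 + 1 / τ) * dispersion b := by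
  have : (fun i => a i - b i - average fun i => a i - b i)
      = fun i => (a i - average a) - (b i - average b) := by
    funext i; rw [average_sub]; abel
  rw [dispersion, this]
  exact meanSq_sub_le hτ _ _

lemma meanSq_smul (c : ℝ) (x : Fin m → Vec d) :
    meanSq (fun i => c • x i) = c ^ 2 * meanSq x := by
  simp only [meanSq, norm_smul, mul_pow, Real.norm_eq_abs, sq_abs, ← Finset.mul_sum]
  ring

lemma dispersion_smul (c : ℝ) (x : Fin m → Vec d) :
    dispersion (fun i => c • x i) = c ^ 2 * dispersion x := by
  rw [dispersion, average_smul, dispersion, ← meanSq_smul]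
  simp only [smul_sub]

lemma IsMixing.average_mix {w : Mat m} (hw : IsMixing w) (x : Fin m → Vec d) :
    average (fun i => ∑ j, w i j • x j) = average x := by
  rw [average, Finset.sum_comm, average]
  simp only [← Finset.sum_smul, hw.2.2, one_smul]

lemma meanSq_mix_le (w : Mat m) (x : Fin m → Vec d) :
    meanSq (fun i => ∑ j, w i j • x j) ≤ specNorm w ^ 2 * meanSq x := by
  rw [meanSq, meanSq, mul_left_comm]
  exact mul_le_mul_of_nonneg_left (sum_norm_sq_mix_le w x) (by positivity)

/-- Mixing contracts the consensus distance. -/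
lemma IsMixing.dispersion_mix_le {w : Mat m} (hw : IsMixing w) (x : Fin m → Vec d) :
    dispersion (fun i => ∑ j, w i j • x j) ≤ specNorm (w - J m) ^ 2 * dispersion x := by
  -- Unit row sums let `w` fix constant families, and `J` annihilates centred ones, so the
  -- deviations evolve under `w - J`.
  have : (fun i => (∑ j, w i j • x j) - average fun i => ∑ j, w i j • x j)
      = fun i => ∑ j, (w - J m) i j • (x j - average x) := by
    funext i
    rw [hw.average_mix]
    simp only [Matrix.sub_apply, sub_smul, smul_sub, Finset.sum_sub_distrib, ← Finset.sum_smul,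
      hw.2.1, J, Matrix.of_apply, ← Finset.smul_sum]
    rw [one_smul]
    have hm : (m : ℝ) ≠ 0 := Nat.cast_ne_zero.mpr i.pos.ne'
    simp [hm, average]
  rw [dispersion, this]
  exact meanSq_mix_le _ _

end Average

/-! ### Gradient of the global objective. -/

section Objective

variable {m d : ℕ} {F : Fin m → Vec d → ℝ} {l : ℝ}

lemma Smooth.hasGradientAt_globalObj (hF : Smooth F l) (x : Vec d) :
    HasGradientAt (globalObj F) (average fun i => gradient (F i) x) x := by
  rw [hasGradientAt_iff_hasFDerivAt]
  have h : ∀ i ∈ Finset.univ, HasFDerivAt (F i)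
      (InnerProductSpace.toDual ℝ (Vec d) (gradient (F i) x)) x :=
    fun i _ => ((hF i).1 x).hasGradientAt.hasFDerivAt
  refine ((HasFDerivAt.fun_sum h).const_mul (1 / (m : ℝ))).congr_fderiv ?_
  simp [average]

lemma Smooth.gradient_globalObj (hF : Smooth F l) (x : Vec d) :
    gradient (globalObj F) x = average fun i => gradient (F i) x :=
  (hF.hasGradientAt_globalObj x).gradient

lemma Smooth.differentiable_globalObj (hF : Smooth F l) : Differentiable ℝ (globalObj F) :=
  fun x => (hF.hasGradientAt_globalObj x).differentiableAt

lemma Smooth.norm_average_gradient_sub_le [NeZero m] (hF : Smooth F l)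
    (x y : Fin m → Vec d) :
    ‖(average fun i => gradient (F i) (x i)) - average fun i => gradient (F i) (y i)‖ ^ 2
      ≤ l ^ 2 * meanSq fun i => x i - y i := by
  rw [← average_sub]
  exact (norm_average_sq_le _).trans (meanSq_le_of_le fun i => (hF i).2 _ _)

lemma Smooth.norm_gradient_globalObj_sub_le [NeZero m] (hl : 0 ≤ l) (hF : Smooth F l)
    (x y : Vec d) :
    ‖gradient (globalObj F) x - gradient (globalObj F) y‖ ≤ l * ‖x - y‖ := by
  have hm : (m : ℝ) ≠ 0 := Nat.cast_ne_zero.mpr (NeZero.ne m)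
  have h := hF.norm_average_gradient_sub_le (fun _ => x) (fun _ => y)
  rw [← hF.gradient_globalObj, ← hF.gradient_globalObj] at h
  refine le_of_sq_le_sq ?_ (by positivity)
  rw [mul_pow]
  simpa [meanSq, hm] using h

lemma Smooth.continuous_gradient (hF : Smooth F l) (i : Fin m) :
    Continuous (gradient (F i)) :=
  (LipschitzWith.of_dist_le' (K := l) fun x y => by
    simpa [dist_eq_norm] using (hF i).2 x y).continuous

lemma Smooth.continuous_gradient_globalObj (hF : Smooth F l) :
    Continuous (gradient (globalObj F)) := by
  have : gradient (globalObj F) = fun x => average fun i => gradient (F i) x :=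
    funext hF.gradient_globalObj
  rw [this]
  exact Continuous.const_smul (continuous_finsetSum _ fun i _ => hF.continuous_gradient i)
    (1 / (m : ℝ))

end Objective

end DPSGD

namespace DPSGD

/-! ### Second moments under independent centred noise. -/

section Noise

variable {m d : ℕ} {Ξ : Type*} [MeasurableSpace Ξ]

lemma integral_norm_const_add_sq {Ω : Type*} [MeasurableSpace Ω] {μ : Measure Ω}
    [IsProbabilityMeasure μ] {u : Ω → Vec d} (hu : MemLp u 2 μ) (h0 : ∫ ω, u ω ∂μ = 0)
    (c : Vec d) : ∫ ω, ‖c + u ω‖ ^ 2 ∂μ = ‖c‖ ^ 2 + ∫ ω, ‖u ω‖ ^ 2 ∂μ := by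
  have hi : Integrable u μ := hu.integrable one_le_two
  have hi2 : Integrable (fun ω => ‖u ω‖ ^ 2) μ := hu.integrable_norm_pow two_ne_zero
  have hin : Integrable (fun ω => inner ℝ c (u ω)) μ := hi.const_inner c
  simp only [norm_add_sq_real]
  have hc : Integrable (fun _ : Ω => ‖c‖ ^ 2) μ := integrable_const _
  rw [integral_add (f := fun ω => ‖c‖ ^ 2 + 2 * inner ℝ c (u ω)) (hc.add (hin.const_mul 2)) hi2,
    integral_add hc (hin.const_mul 2), integral_const_mul, integral_inner hi, h0]
  simp

variable {D : Fin m → Measure Ξ} [∀ i, IsProbabilityMeasure (D i)] {X : Fin m → Ξ → Vec d}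

lemma integral_pi_eval {E : Type*} [NormedAddCommGroup E] [NormedSpace ℝ E] (i : Fin m)
    {f : Ξ → E} (hf : AEStronglyMeasurable f (D i)) :
    ∫ s, f (s i) ∂(Measure.pi D) = ∫ s, f s ∂(D i) :=
  integral_comp_eval (X := fun _ => Ξ) (μ := D) (i := i) (f := f) hf

lemma memLp_eval (hX : ∀ i, MemLp (X i) 2 (D i)) (i : Fin m) :
    MemLp (fun s : Fin m → Ξ => X i (s i)) 2 (Measure.pi D) :=
  (hX i).comp_measurePreserving (measurePreserving_eval _ i)

lemma integral_eval (hX : ∀ i, MemLp (X i) 2 (D i)) (i : Fin m) :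
    ∫ s, X i (s i) ∂(Measure.pi D) = ∫ s, X i s ∂(D i) :=
  integral_pi_eval i (hX i).1

lemma integral_norm_sq_eval (hX : ∀ i, MemLp (X i) 2 (D i)) (i : Fin m) :
    ∫ s, ‖X i (s i)‖ ^ 2 ∂(Measure.pi D) = ∫ s, ‖X i s‖ ^ 2 ∂(D i) :=
  integral_pi_eval i (f := fun s => ‖X i s‖ ^ 2) ((hX i).1.norm.pow 2)

/-- The second moment of a sum of independent centred vectors. -/
lemma integral_norm_sq_sum (hX : ∀ i, MemLp (X i) 2 (D i)) (h0 : ∀ i, ∫ s, X i s ∂(D i) = 0) :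
    ∫ s, ‖∑ i, X i (s i)‖ ^ 2 ∂(Measure.pi D) = ∑ i, ∫ s, ‖X i s‖ ^ 2 ∂(D i) := by
  have hc : ∀ i c, MemLp (fun s => X i s c) 2 (D i) := fun i c =>
    (EuclideanSpace.proj (𝕜 := ℝ) c).comp_memLp' (hX i)
  have hc0 : ∀ i c, ∫ s, X i s c ∂(D i) = 0 := fun i c => by
    have := (EuclideanSpace.proj (𝕜 := ℝ) c).integral_comp_comm ((hX i).integrable one_le_two)
    rw [h0] at this
    simpa using this
  have hce : ∀ i c, MemLp (fun s : Fin m → Ξ => X i (s i) c) 2 (Measure.pi D) := fun i c =>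
    (hc i c).comp_measurePreserving (measurePreserving_eval _ i)
  have hsum : ∀ c, MemLp (∑ i, fun s : Fin m → Ξ => X i (s i) c) 2 (Measure.pi D) := fun c =>
    memLp_finsetSum' _ fun i _ => hce i c
  -- In each coordinate this is additivity of variance over a product measure, with means zero.
  have hvar : ∀ c, ∫ s, (∑ i, X i (s i) c) ^ 2 ∂(Measure.pi D)
      = ∑ i, ∫ s, X i s c ^ 2 ∂(D i) := fun c => by
    have h1 := variance_sum_pi fun i => hc i c
    rw [variance_of_integral_eq_zero (hsum c).aemeasurable] at h1
    · simp only [Finset.sum_apply] at h1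
      rw [h1]
      exact Finset.sum_congr rfl fun i _ =>
        variance_of_integral_eq_zero (hc i c).aemeasurable (hc0 i c)
    · simp only [Finset.sum_apply]
      rw [integral_finsetSum _ fun i _ => (hce i c).integrable one_le_two]
      refine Finset.sum_eq_zero fun i _ => ?_
      rw [integral_pi_eval i (f := fun s => X i s c) (hc i c).1, hc0]
  simp only [EuclideanSpace.real_norm_sq_eq, WithLp.ofLp_sum, Finset.sum_apply]
  rw [integral_finsetSum _ fun c _ => by
    simpa only [Finset.sum_apply] using (hsum c).integrable_sq]
  have : ∀ i, ∫ s, ∑ c, X i s c ^ 2 ∂(D i) = ∑ c, ∫ s, X i s c ^ 2 ∂(D i) := fun i =>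
    integral_finsetSum _ fun c _ => (hc i c).integrable_sq
  simp only [this, hvar]
  exact Finset.sum_comm

/-- The mean noise level of the family `X`. -/
noncomputable def noiseLevel (D : Fin m → Measure Ξ) (X : Fin m → Ξ → Vec d) : ℝ :=
  (1 / (m : ℝ)) * ∑ i, ∫ s, ‖X i s‖ ^ 2 ∂(D i)

lemma memLp_average (hX : ∀ i, MemLp (X i) 2 (D i)) :
    MemLp (fun s : Fin m → Ξ => average fun i => X i (s i)) 2 (Measure.pi D) :=
  (memLp_finsetSum _ fun i _ => memLp_eval hX i).const_smul (1 / (m : ℝ))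

lemma integral_average (hX : ∀ i, MemLp (X i) 2 (D i)) :
    ∫ s, (average fun i => X i (s i)) ∂(Measure.pi D) = average fun i => ∫ s, X i s ∂(D i) := by
  simp only [average]
  rw [integral_smul, integral_finsetSum _ fun i _ => (memLp_eval hX i).integrable one_le_two]
  simp only [integral_eval hX]

lemma integral_norm_sq_average (hX : ∀ i, MemLp (X i) 2 (D i))
    (h0 : ∀ i, ∫ s, X i s ∂(D i) = 0) :
    ∫ s, ‖average fun i => X i (s i)‖ ^ 2 ∂(Measure.pi D) = (1 / (m : ℝ)) * noiseLevel D X := by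
  simp only [average, norm_smul, mul_pow]
  rw [integral_const_mul, integral_norm_sq_sum hX h0, noiseLevel, Real.norm_eq_abs, sq_abs]
  ring

lemma integral_norm_sq_const_add_average (hX : ∀ i, MemLp (X i) 2 (D i))
    (h0 : ∀ i, ∫ s, X i s ∂(D i) = 0) (c : Vec d) :
    ∫ s, ‖c + average fun i => X i (s i)‖ ^ 2 ∂(Measure.pi D)
      = ‖c‖ ^ 2 + (1 / (m : ℝ)) * noiseLevel D X := by
  rw [integral_norm_const_add_sq (memLp_average hX) _ c, integral_norm_sq_average hX h0]
  rw [integral_average hX]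
  simp [h0, average]

lemma integral_meanSq_add (hX : ∀ i, MemLp (X i) 2 (D i))
    (h0 : ∀ i, ∫ s, X i s ∂(D i) = 0) (a : Fin m → Vec d) :
    ∫ s, meanSq (fun i => a i + X i (s i)) ∂(Measure.pi D) = meanSq a + noiseLevel D X := by
  simp only [meanSq]
  rw [integral_const_mul, integral_finsetSum]
  · have : ∀ i, ∫ s, ‖a i + X i (s i)‖ ^ 2 ∂(Measure.pi D)
        = ‖a i‖ ^ 2 + ∫ s, ‖X i s‖ ^ 2 ∂(D i) := fun i => by
      rw [integral_norm_const_add_sq (memLp_eval hX i) (by rw [integral_eval hX, h0]),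
        integral_norm_sq_eval hX]
    simp only [this, Finset.sum_add_distrib, noiseLevel, mul_add]
  · exact fun i _ => ((memLp_const (a i)).add (memLp_eval hX i)).integrable_norm_pow two_ne_zero

lemma integrable_meanSq_add (hX : ∀ i, MemLp (X i) 2 (D i)) (a : Fin m → Vec d) :
    Integrable (fun s => meanSq (fun i => a i + X i (s i))) (Measure.pi D) :=
  (integrable_finsetSum _ fun i _ =>
    ((memLp_const (a i)).add (memLp_eval hX i)).integrable_norm_pow two_ne_zero).const_mul _

lemma noiseLevel_nonneg (D : Fin m → Measure Ξ) (X : Fin m → Ξ → Vec d) : 0 ≤ noiseLevel D X :=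
  mul_nonneg (by positivity)
    (Finset.sum_nonneg fun _ _ => integral_nonneg fun _ => sq_nonneg _)

lemma noiseLevel_smul (D : Fin m → Measure Ξ) (X : Fin m → Ξ → Vec d) (c : ℝ) :
    noiseLevel D (fun i s => c • X i s) = c ^ 2 * noiseLevel D X := by
  simp only [noiseLevel, norm_smul, mul_pow, integral_const_mul, ← Finset.mul_sum,
    Real.norm_eq_abs, sq_abs]
  ring

/-- Independent centred noise increases the consensus distance by at most its level. -/
lemma integral_dispersion_add_le [NeZero m] (hX : ∀ i, MemLp (X i) 2 (D i))
    (h0 : ∀ i, ∫ s, X i s ∂(D i) = 0) (a : Fin m → Vec d) :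
    ∫ s, dispersion (fun i => a i + X i (s i)) ∂(Measure.pi D)
      ≤ dispersion a + noiseLevel D X := by
  simp only [dispersion_eq, average_add]
  rw [integral_sub (integrable_meanSq_add hX a), integral_meanSq_add hX h0,
    integral_norm_sq_const_add_average hX h0]
  -- By the bias-variance formula the exact increase is the noise level minus this term, which is
  -- dropped.
  · have : 0 ≤ 1 / (m : ℝ) * noiseLevel D X := mul_nonneg (by positivity) (noiseLevel_nonneg D X)
    linarith
  · exact ((memLp_const (average a)).add (memLp_average hX)).integrable_norm_pow two_ne_zero

end Noise

/-! ### Quadratic growth, the source of integrability along the iterates. -/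

section QuadraticGrowth

variable {m d : ℕ}

/-- Measurable functions that grow at most quadratically. -/
def QuadraticGrowth (h : (Fin m → Vec d) → ℝ) : Prop :=
  Measurable h ∧ ∃ c, ∀ x, |h x| ≤ c * (1 + meanSq x)

lemma continuous_average : Continuous (average : (Fin m → Vec d) → Vec d) := by
  unfold average; fun_prop

lemma continuous_meanSq : Continuous (meanSq : (Fin m → Vec d) → ℝ) := by
  unfold meanSq; fun_prop

lemma continuous_dispersion : Continuous (dispersion : (Fin m → Vec d) → ℝ) := by
  have := continuous_average (m := m) (d := d)
  unfold dispersion meanSq; fun_prop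

lemma quadraticGrowth_dispersion [NeZero m] :
    QuadraticGrowth (dispersion : (Fin m → Vec d) → ℝ) :=
  ⟨continuous_dispersion.measurable, 1, fun x => by
    rw [abs_of_nonneg (dispersion_nonneg x)]
    linarith [dispersion_le_meanSq x]⟩

lemma QuadraticGrowth.integrable {h : (Fin m → Vec d) → ℝ} (hh : QuadraticGrowth h)
    {Ω : Type*} [MeasurableSpace Ω] {P : Measure Ω} [IsFiniteMeasure P]
    {Z : Ω → Fin m → Vec d} (hZ : Measurable Z) (hi : Integrable (fun ω => meanSq (Z ω)) P) :
    Integrable (fun ω => h (Z ω)) P := by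
  obtain ⟨hm, c, hc⟩ := hh
  exact (((integrable_const 1).add hi).const_mul c).mono' (hm.comp hZ).aestronglyMeasurable
    (ae_of_all _ fun ω => hc (Z ω))

variable {F : Fin m → Vec d → ℝ} {l : ℝ}

lemma quadraticGrowth_sqGrad [NeZero m] (hl : 0 ≤ l) (hF : Smooth F l) :
    QuadraticGrowth fun x : Fin m → Vec d => ‖gradient (globalObj F) (average x)‖ ^ 2 := by
  refine ⟨((hF.continuous_gradient_globalObj.comp continuous_average).norm.pow 2).measurable,
    2 * ‖gradient (globalObj F) 0‖ ^ 2 + 2 * l ^ 2, fun x => ?_⟩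
  rw [abs_of_nonneg (sq_nonneg _)]
  have h1 := hF.norm_gradient_globalObj_sub_le hl (average x) 0
  have h2 := norm_le_norm_add_norm_sub' (gradient (globalObj F) (average x))
    (gradient (globalObj F) 0)
  rw [sub_zero] at h1
  have h3 : ‖gradient (globalObj F) (average x)‖
      ≤ ‖gradient (globalObj F) 0‖ + l * ‖average x‖ := by linarith
  have h4 := pow_le_pow_left₀ (norm_nonneg _) h3 2
  have h5 := norm_average_sq_le x
  have h6 := add_pow_le (norm_nonneg (gradient (globalObj F) 0))
    (mul_nonneg hl (norm_nonneg (average x))) 2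
  have h7 : l ^ 2 * ‖average x‖ ^ 2 ≤ l ^ 2 * meanSq x :=
    mul_le_mul_of_nonneg_left h5 (sq_nonneg _)
  have h8 : 0 ≤ ‖gradient (globalObj F) 0‖ ^ 2 * meanSq x :=
    mul_nonneg (sq_nonneg _) (meanSq_nonneg x)
  nlinarith [sq_nonneg l]

/-- The descent lemma at 0 bounds the objective above; the constant `c` bounds it below. -/
lemma quadraticGrowth_globalObj [NeZero m] (hl : 0 ≤ l) (hF : Smooth F l) {c : ℝ}
    (hc : ∀ x, c ≤ globalObj F x) :
    QuadraticGrowth fun x : Fin m → Vec d => globalObj F (average x) := by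
  set G := ‖gradient (globalObj F) 0‖
  refine ⟨(hF.differentiable_globalObj.continuous.comp continuous_average).measurable,
    |c| + |globalObj F 0| + G + l, fun x => ?_⟩
  have h1 := le_add_of_lipschitz_gradient hF.differentiable_globalObj
    (hF.norm_gradient_globalObj_sub_le hl) 0 (average x)
  rw [zero_add] at h1
  have h2 := real_inner_le_norm (gradient (globalObj F) 0) (average x)
  have h3 := norm_average_sq_le x
  have h4 := meanSq_nonneg x
  have h5 : 2 * ‖average x‖ ≤ 1 + ‖average x‖ ^ 2 := by nlinarith [sq_nonneg (‖average x‖ - 1)]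
  have h6 : G * ‖average x‖ ≤ G * (1 + meanSq x) :=
    mul_le_mul_of_nonneg_left (by linarith) (norm_nonneg _)
  have h7 : l / 2 * ‖average x‖ ^ 2 ≤ l * (1 + meanSq x) := by nlinarith
  have h8 : |c| ≤ |c| * (1 + meanSq x) := le_mul_of_one_le_right (abs_nonneg _) (by linarith)
  have h9 : |globalObj F 0| ≤ |globalObj F 0| * (1 + meanSq x) :=
    le_mul_of_one_le_right (abs_nonneg _) (by linarith)
  have h10 : 0 ≤ G * (1 + meanSq x) := mul_nonneg (norm_nonneg _) (by linarith)
  have h11 : 0 ≤ l * (1 + meanSq x) := mul_nonneg hl (by linarith)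
  rw [abs_le]
  constructor
  · have := hc (average x)
    linarith [neg_abs_le c, abs_nonneg c, abs_nonneg (globalObj F 0)]
  · linarith [le_abs_self (globalObj F 0), abs_nonneg c]

end QuadraticGrowth

end DPSGD

namespace DPSGD

/-! ### One iteration from a fixed point. -/

section OneStep

variable {m d : ℕ} {Ξ : Type*}

/-- One iteration of D-PSGD from `x`, with mixing matrix `w` and mini-batches `s`. -/
noncomputable def step (η : ℝ) (g : Vec d → Ξ → Vec d) (x : Fin m → Vec d) (w : Mat m)
    (s : Fin m → Ξ) : Fin m → Vec d :=
  fun i => (∑ j, w i j • x j) - η • g (x i) (s i)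

/-- The error of the stochastic gradient of agent `i` at `x i`. -/
noncomputable def noise (F : Fin m → Vec d → ℝ) (g : Vec d → Ξ → Vec d) (x : Fin m → Vec d)
    (i : Fin m) (s : Ξ) : Vec d :=
  g (x i) s - gradient (F i) (x i)

/-- Separates the drift, fixed once the point and the mixing matrix are, from the centred noise of
the mini-batches. -/
lemma step_eq (F : Fin m → Vec d → ℝ) (η : ℝ) (g : Vec d → Ξ → Vec d) (x : Fin m → Vec d)
    (w : Mat m) (s : Fin m → Ξ) :
    step η g x w s = fun i => ((∑ j, w i j • x j) - η • gradient (F i) (x i))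
      + (-η) • noise F g x i (s i) := by
  funext i
  rw [step, noise, neg_smul, smul_sub]
  abel

variable [MeasurableSpace Ξ]

/-- The standing assumptions on objectives, stochastic gradients and the law of the mixing
matrices. -/
structure IsModel (F : Fin m → Vec d → ℝ) (g : Vec d → Ξ → Vec d) (D : Fin m → Measure Ξ)
    (l σ ζ M₁ M₂ : ℝ) (ν : Measure (Mat m)) : Prop where
  l_nonneg : 0 ≤ l
  M₁_nonneg : 0 ≤ M₁
  M₂_nonneg : 0 ≤ M₂
  prob : ∀ i, IsProbabilityMeasure (D i)
  stochasticGradient : IsStochasticGradient F g D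
  smooth : Smooth F l
  noiseBound : NoiseBound F g D σ M₁
  heterogeneityBound : HeterogeneityBound F ζ M₂
  probMixing : IsProbabilityMeasure ν
  isMixing : ∀ᵐ w ∂ν, IsMixing w
  finite : FiniteMeanSqDist ν

lemma meanSq_le_two_mul (a b : Fin m → Vec d) :
    meanSq a ≤ 2 * meanSq b + 2 * meanSq fun i => b i - a i := by
  have h := meanSq_sub_le one_pos b fun i => b i - a i
  simp only [sub_sub_cancel] at h
  norm_num at h
  exact h

lemma measurable_step {g : Vec d → Ξ → Vec d} (hg : Measurable (Function.uncurry g)) (η : ℝ)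
    {Ω : Type*} [MeasurableSpace Ω] {X : Ω → Fin m → Vec d} {W : Ω → Mat m} {S : Ω → Fin m → Ξ}
    (hX : Measurable X) (hW : Measurable W) (hS : Measurable S) :
    Measurable fun ω => step η g (X ω) (W ω) (S ω) := by
  refine measurable_pi_lambda _ fun i => ?_
  have hx : ∀ j, Measurable fun ω => X ω j := fun j => (measurable_pi_apply j).comp hX
  have hw : ∀ j, Measurable fun ω => W ω i j := fun j =>
    (measurable_pi_apply (X := fun _ : Fin m => ℝ) j).comp
      ((measurable_pi_apply (X := fun _ : Fin m => Fin m → ℝ) i).comp hW)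
  exact (Finset.measurable_fun_sum _ fun j _ => (hw j).smul (hx j)).sub
    ((hg.comp ((hx i).prodMk ((measurable_pi_apply i).comp hS))).const_smul η)

lemma measurable_step_right {g : Vec d → Ξ → Vec d} (hg : Measurable (Function.uncurry g))
    (η : ℝ) (x : Fin m → Vec d) :
    Measurable fun y : Mat m × (Fin m → Ξ) => step η g x y.1 y.2 :=
  measurable_step hg η measurable_const measurable_fst measurable_snd

variable {F : Fin m → Vec d → ℝ} {g : Vec d → Ξ → Vec d} {D : Fin m → Measure Ξ}
  {l σ ζ M₁ M₂ : ℝ} {ν : Measure (Mat m)}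

namespace IsModel

lemma memLp_noise (h : IsModel F g D l σ ζ M₁ M₂ ν) (x : Fin m → Vec d) (i : Fin m) :
    MemLp (noise F g x i) 2 (D i) :=
  have := h.prob i
  (h.stochasticGradient.memLp i (x i)).sub (memLp_const _)

lemma integral_noise (h : IsModel F g D l σ ζ M₁ M₂ ν) (x : Fin m → Vec d) (i : Fin m) :
    ∫ s, noise F g x i s ∂(D i) = 0 := by
  have := h.prob i
  simp only [noise]
  rw [integral_sub ((h.stochasticGradient.memLp i (x i)).integrable one_le_two)
    (integrable_const _), h.stochasticGradient.unbiased]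
  simp

/-- The assumed bound involves gradients at the individual agents; moving them to the average costs
a factor 2 and, by smoothness, a multiple of the consensus distance. -/
lemma noiseLevel_noise_le [NeZero m] (h : IsModel F g D l σ ζ M₁ M₂ ν) (x : Fin m → Vec d) :
    noiseLevel D (noise F g x) ≤ σ ^ 2
      + 2 * M₁ * (‖gradient (globalObj F) (average x)‖ ^ 2 + l ^ 2 * dispersion x) := by
  have hm : (m : ℝ) ≠ 0 := Nat.cast_ne_zero.mpr (NeZero.ne m)
  have h1 : noiseLevel D (noise F g x)
      ≤ σ ^ 2 + M₁ * meanSq fun i => gradient (globalObj F) (x i) := by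
    have := h.noiseBound x
    rw [noiseLevel, meanSq, ← mul_assoc, mul_one_div]
    exact this
  have h2 := meanSq_le_two_mul (fun i => gradient (globalObj F) (x i))
    (fun _ => gradient (globalObj F) (average x))
  have h3 : meanSq (fun i => gradient (globalObj F) (average x) - gradient (globalObj F) (x i))
      ≤ l ^ 2 * dispersion x := by
    rw [dispersion]
    refine meanSq_le_of_le fun i => ?_
    rw [norm_sub_rev]
    exact h.smooth.norm_gradient_globalObj_sub_le h.l_nonneg _ _
  have h4 : meanSq (fun _ : Fin m => gradient (globalObj F) (average x))
      = ‖gradient (globalObj F) (average x)‖ ^ 2 := by simp [meanSq, hm]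
  rw [h4] at h2
  nlinarith [mul_le_mul_of_nonneg_left (h2.trans (by linarith :
    _ ≤ 2 * (‖gradient (globalObj F) (average x)‖ ^ 2 + l ^ 2 * dispersion x))) h.M₁_nonneg]

lemma meanSq_gradient_le (h : IsModel F g D l σ ζ M₁ M₂ ν) (x : Fin m → Vec d) :
    meanSq (fun i => gradient (F i) (x i))
      ≤ 2 * (ζ ^ 2 + M₂ * ‖gradient (globalObj F) (average x)‖ ^ 2)
        + 2 * (l ^ 2 * dispersion x) := by
  have h2 := meanSq_le_two_mul (fun i => gradient (F i) (x i))
    (fun i => gradient (F i) (average x))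
  have h3 : meanSq (fun i => gradient (F i) (average x) - gradient (F i) (x i))
      ≤ l ^ 2 * dispersion x := by
    rw [dispersion]
    refine meanSq_le_of_le fun i => ?_
    rw [norm_sub_rev]
    exact (h.smooth i).2 _ _
  have h4 : meanSq (fun i => gradient (F i) (average x)) ≤ _ := h.heterogeneityBound (average x)
  linarith

lemma integrable_specNorm_sq (h : IsModel F g D l σ ζ M₁ M₂ ν) :
    Integrable (fun w => specNorm w ^ 2) ν := by
  have := h.probMixing
  refine ((h.finite.const_mul 2).add (integrable_const (2 * specNorm (J m) ^ 2))).mono'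
    (continuous_specNorm.pow 2).aestronglyMeasurable (ae_of_all _ fun w => ?_)
  rw [Real.norm_of_nonneg (sq_nonneg _)]
  have h1 : specNorm w ≤ specNorm (w - J m) + specNorm (J m) := by
    have h2 := norm_add_le (Matrix.toEuclideanCLM (n := Fin m) (𝕜 := ℝ) (w - J m))
      (Matrix.toEuclideanCLM (n := Fin m) (𝕜 := ℝ) (J m))
    rwa [← map_add, sub_add_cancel] at h2
  have h3 := pow_le_pow_left₀ (specNorm_nonneg w) h1 2
  simp only [Pi.add_apply]
  nlinarith [sq_nonneg (specNorm (w - J m) - specNorm (J m))]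

/-- One iteration from a fixed point has finite second moments, growing at most quadratically. -/
lemma exists_integral_meanSq_step_le [NeZero m] (h : IsModel F g D l σ ζ M₁ M₂ ν) (η : ℝ) :
    ∃ A, ∀ x : Fin m → Vec d,
      Integrable (fun y => meanSq (step η g x y.1 y.2)) (ν.prod (Measure.pi D)) ∧
      ∫ y, meanSq (step η g x y.1 y.2) ∂(ν.prod (Measure.pi D)) ≤ A * (1 + meanSq x) := by
  have := h.prob
  have := h.probMixing
  obtain ⟨-, c, hc⟩ := quadraticGrowth_sqGrad (m := m) h.l_nonneg h.smooth
  have hc0 : 0 ≤ c := by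
    have := (abs_nonneg _).trans (hc 0)
    simpa [meanSq] using this
  set S := ∫ w, specNorm w ^ 2 ∂ν
  have hS : 0 ≤ S := integral_nonneg fun _ => sq_nonneg _
  -- `B` bounds the second moment of the stochastic gradients relative to `1 + meanSq x`: that of
  -- the true gradients plus the noise level.
  set B := 2 * (ζ ^ 2 + M₂ * c + l ^ 2) + (σ ^ 2 + 2 * M₁ * (c + l ^ 2))
  refine ⟨2 * S + 2 * η ^ 2 * B, fun x => ?_⟩
  have hX : ∀ i, MemLp (noise F g x i) 2 (D i) := h.memLp_noise x
  have hgi : Integrable (fun s => meanSq fun i => g (x i) (s i)) (Measure.pi D) := by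
    have := integrable_meanSq_add hX fun i => gradient (F i) (x i)
    simpa [noise] using this
  have hgv : ∫ s, (meanSq fun i => g (x i) (s i)) ∂(Measure.pi D) ≤ B * (1 + meanSq x) := by
    have h1 := integral_meanSq_add hX (h.integral_noise x) fun i => gradient (F i) (x i)
    simp only [noise, add_sub_cancel] at h1
    have h2 := h.noiseLevel_noise_le x
    have h3 := h.meanSq_gradient_le x
    have h4 : ‖gradient (globalObj F) (average x)‖ ^ 2 ≤ c * (1 + meanSq x) :=
      (le_abs_self _).trans (hc x)
    have h5 := dispersion_le_meanSq x
    have h6 : l ^ 2 * dispersion x ≤ l ^ 2 * (1 + meanSq x) :=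
      mul_le_mul_of_nonneg_left (by linarith) (sq_nonneg l)
    have h7 := mul_le_mul_of_nonneg_left h4 h.M₂_nonneg
    have h8 := mul_le_mul_of_nonneg_left (add_le_add h4 h6) h.M₁_nonneg
    have h9 := mul_nonneg (sq_nonneg ζ) (meanSq_nonneg x)
    have h10 := mul_nonneg (sq_nonneg σ) (meanSq_nonneg x)
    rw [h1]
    simp only [B]
    nlinarith
  have hbound : ∀ y : Mat m × (Fin m → Ξ), meanSq (step η g x y.1 y.2)
      ≤ 2 * meanSq x * specNorm y.1 ^ 2 + 2 * η ^ 2 * meanSq fun i => g (x i) (y.2 i) := fun y => by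
    have h1 := meanSq_sub_le one_pos (fun i => ∑ j, y.1 i j • x j) fun i => η • g (x i) (y.2 i)
    rw [meanSq_smul] at h1
    norm_num at h1
    have h2 := meanSq_mix_le y.1 x
    have h3 : meanSq (step η g x y.1 y.2)
        = meanSq fun i => (∑ j, y.1 i j • x j) - η • g (x i) (y.2 i) := rfl
    rw [h3]
    linarith
  have hi1 : Integrable (fun y : Mat m × (Fin m → Ξ) => 2 * meanSq x * specNorm y.1 ^ 2)
      (ν.prod (Measure.pi D)) := (h.integrable_specNorm_sq.comp_fst _).const_mul _
  have hi2 : Integrable (fun y : Mat m × (Fin m → Ξ) =>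
      2 * η ^ 2 * meanSq fun i => g (x i) (y.2 i)) (ν.prod (Measure.pi D)) :=
    (hgi.comp_snd _).const_mul _
  have hi : Integrable (fun y => meanSq (step η g x y.1 y.2)) (ν.prod (Measure.pi D)) := by
    refine (hi1.add hi2).mono' (continuous_meanSq.measurable.comp
      (measurable_step_right h.stochasticGradient.measurable η x)).aestronglyMeasurable
      (ae_of_all _ fun y => ?_)
    rw [Real.norm_of_nonneg (meanSq_nonneg _)]
    exact hbound y
  refine ⟨hi, (integral_mono hi (hi1.add hi2) hbound).trans ?_⟩
  simp only [Pi.add_apply]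
  rw [integral_add hi1 hi2, integral_const_mul, integral_const_mul,
    integral_fun_fst (fun w : Mat m => specNorm w ^ 2),
    integral_fun_snd (fun s : Fin m → Ξ => meanSq fun i => g (x i) (s i))]
  simp only [probReal_univ, one_smul]
  have h1 := mul_le_mul_of_nonneg_left hgv (by positivity : 0 ≤ 2 * η ^ 2)
  nlinarith [meanSq_nonneg x]

/-- The consensus distance after one iteration. -/
lemma integral_dispersion_step_le [NeZero m] (h : IsModel F g D l σ ζ M₁ M₂ ν) (η : ℝ)
    {τ : ℝ} (hτ : 0 < τ) (x : Fin m → Vec d) :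
    ∫ y, dispersion (step η g x y.1 y.2) ∂(ν.prod (Measure.pi D))
      ≤ (1 + τ) * (meanSqDist ν * dispersion x)
        + (1 + 1 / τ) * (η ^ 2 * meanSq fun i => gradient (F i) (x i))
        + η ^ 2 * noiseLevel D (noise F g x) := by
  have := h.prob
  have := h.probMixing
  obtain ⟨A, hA⟩ := h.exists_integral_meanSq_step_le η
  have hi : Integrable (fun y : Mat m × (Fin m → Ξ) => dispersion (step η g x y.1 y.2))
      (ν.prod (Measure.pi D)) :=
    quadraticGrowth_dispersion.integrable
      (measurable_step_right h.stochasticGradient.measurable η x) (hA x).1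
  rw [integral_prod _ hi]
  set c := (1 + 1 / τ) * (η ^ 2 * meanSq fun i => gradient (F i) (x i))
    + η ^ 2 * noiseLevel D (noise F g x)
  have hR : Integrable (fun w => (1 + τ) * dispersion x * specNorm (w - J m) ^ 2 + c) ν :=
    (h.finite.const_mul _).add (integrable_const c)
  refine (integral_mono_ae hi.integral_prod_left hR (h.isMixing.mono fun w hw => ?_)).trans ?_
  -- The noise is split off before Young's inequality, so only the gradients pay 1 + 1/τ. This is
  -- why σ carries √p in `K` and ζ does not.
  · have h1 := integral_dispersion_add_le (D := D) (X := fun i s => (-η) • noise F g x i s)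
      (fun i => (h.memLp_noise x i).const_smul (-η))
      (fun i => by rw [integral_smul, h.integral_noise, smul_zero])
      (fun i => (∑ j, w i j • x j) - η • gradient (F i) (x i))
    rw [noiseLevel_smul, neg_sq] at h1
    simp only [step_eq F]
    refine h1.trans ?_
    have h2 := dispersion_sub_le hτ (fun i => ∑ j, w i j • x j)
      fun i => η • gradient (F i) (x i)
    rw [dispersion_smul] at h2
    have h3 := mul_le_mul_of_nonneg_left (hw.dispersion_mix_le x) (by linarith : 0 ≤ 1 + τ)
    have h4 : (1 + 1 / τ) * (η ^ 2 * dispersion fun i => gradient (F i) (x i))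
        ≤ (1 + 1 / τ) * (η ^ 2 * meanSq fun i => gradient (F i) (x i)) := by
      gcongr
      exact dispersion_le_meanSq _
    simp only [c]
    linarith
  · rw [integral_add (h.finite.const_mul _) (integrable_const c), integral_const_mul]
    simp only [integral_const, probReal_univ, one_smul, c, meanSqDist]
    linarith

/-- The objective at the average after one iteration. -/
lemma integral_globalObj_step_le [NeZero m] (h : IsModel F g D l σ ζ M₁ M₂ ν) {Finf : ℝ}
    (hinf : ∀ x, Finf ≤ globalObj F x) (η : ℝ) (x : Fin m → Vec d) :
    ∫ y, globalObj F (average (step η g x y.1 y.2)) ∂(ν.prod (Measure.pi D))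
      ≤ globalObj F (average x)
        - η * inner ℝ (gradient (globalObj F) (average x)) (average fun i => gradient (F i) (x i))
        + l / 2 * (η ^ 2 * (‖average fun i => gradient (F i) (x i)‖ ^ 2
          + 1 / (m : ℝ) * noiseLevel D (noise F g x))) := by
  have := h.prob
  have := h.probMixing
  obtain ⟨A, hA⟩ := h.exists_integral_meanSq_step_le η
  set a := gradient (globalObj F) (average x)
  set b := average fun i => gradient (F i) (x i)
  set N : (Fin m → Ξ) → Vec d := fun s => average fun i => noise F g x i (s i)
  have hi : Integrable
      (fun y : Mat m × (Fin m → Ξ) => globalObj F (average (step η g x y.1 y.2)))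
      (ν.prod (Measure.pi D)) :=
    (quadraticGrowth_globalObj h.l_nonneg h.smooth hinf).integrable
      (measurable_step_right h.stochasticGradient.measurable η x) (hA x).1
  have hN : MemLp N 2 (Measure.pi D) := memLp_average (h.memLp_noise x)
  have hN0 : ∫ s, N s ∂(Measure.pi D) = 0 := by
    rw [integral_average (h.memLp_noise x)]
    simp [h.integral_noise, average]
  have hi1 : Integrable (fun s => inner ℝ a (b + N s)) (Measure.pi D) :=
    (((memLp_const b).add hN).integrable one_le_two).const_inner a
  have hi2 : Integrable (fun s => ‖b + N s‖ ^ 2) (Measure.pi D) :=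
    ((memLp_const b).add hN).integrable_norm_pow two_ne_zero
  -- The descent bound along the averaged step; it is free of the mixing matrix because mixing
  -- preserves the average.
  set R : (Fin m → Ξ) → ℝ := fun s =>
    globalObj F (average x) - η * inner ℝ a (b + N s) + l / 2 * (η ^ 2 * ‖b + N s‖ ^ 2)
  have hc : Integrable (fun _ : Fin m → Ξ => globalObj F (average x)) (Measure.pi D) :=
    integrable_const _
  have hRi : Integrable R (Measure.pi D) :=
    (hc.sub (hi1.const_mul η)).add ((hi2.const_mul (η ^ 2)).const_mul (l / 2))
  have hle : ∀ᵐ y ∂(ν.prod (Measure.pi D)),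
      globalObj F (average (step η g x y.1 y.2)) ≤ R y.2 := by
    have hmix : ∀ᵐ y ∂(ν.prod (Measure.pi D)), IsMixing y.1 :=
      Measure.quasiMeasurePreserving_fst.ae h.isMixing
    refine hmix.mono fun y hy => ?_
    have havg : average (step η g x y.1 y.2) = average x + -(η • (b + N y.2)) := by
      have h1 : average (step η g x y.1 y.2)
          = average x - η • average fun i => g (x i) (y.2 i) := by
        rw [← hy.average_mix x, ← average_smul, ← average_sub]
        rfl
      have h2 : b + N y.2 = average fun i => g (x i) (y.2 i) := by
        simp only [b, N]
        rw [← average_add]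
        simp [noise]
      rw [h1, h2, sub_eq_add_neg]
    have h1 := le_add_of_lipschitz_gradient h.smooth.differentiable_globalObj
      (h.smooth.norm_gradient_globalObj_sub_le h.l_nonneg) (average x) (-(η • (b + N y.2)))
    rw [havg]
    refine h1.trans (le_of_eq ?_)
    rw [inner_neg_right, inner_smul_right, norm_neg, norm_smul, mul_pow, Real.norm_eq_abs, sq_abs]
    simp only [R, a]
    ring
  refine (integral_mono_ae hi (hRi.comp_snd ν) hle).trans (le_of_eq ?_)
  rw [integral_fun_snd R]
  simp only [probReal_univ, one_smul, R]
  rw [integral_add (f := fun s => globalObj F (average x) - η * inner ℝ a (b + N s))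
      (hc.sub (hi1.const_mul η)) ((hi2.const_mul (η ^ 2)).const_mul (l / 2)),
    integral_sub hc (hi1.const_mul η), integral_const_mul, integral_const_mul, integral_const_mul,
    integral_inner (f := fun s => b + N s) (((memLp_const b).add hN).integrable one_le_two),
    integral_add (integrable_const b) (hN.integrable one_le_two), hN0,
    integral_norm_sq_const_add_average (h.memLp_noise x) (h.integral_noise x)]
  simp

end IsModel

end OneStep

end DPSGD

namespace DPSGD

/-! ### Random iterates and the two recursions in expectation. -/

section Iterates

variable {m d : ℕ} {Ξ Ω : Type*} [MeasurableSpace Ξ] {F : Fin m → Vec d → ℝ}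
  {g : Vec d → Ξ → Vec d} {D : Fin m → Measure Ξ} {l σ ζ M₁ M₂ : ℝ} {ν : Measure (Mat m)}
  {W : ℕ → Ω → Mat m} {ξ : ℕ → Fin m → Ω → Ξ}

lemma measurable_step_uncurried (hg : Measurable (Function.uncurry g)) (η : ℝ) :
    Measurable fun z : (Fin m → Vec d) × (Mat m × (Fin m → Ξ)) => step η g z.1 z.2.1 z.2.2 :=
  measurable_step hg η measurable_fst (measurable_fst.comp measurable_snd)
    (measurable_snd.comp measurable_snd)

/-- The random iterates of D-PSGD. -/
noncomputable def process (η : ℝ) (g : Vec d → Ξ → Vec d) (x₁ : Vec d) (W : ℕ → Ω → Mat m)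
    (ξ : ℕ → Fin m → Ω → Ξ) (k : ℕ) (ω : Ω) : Fin m → Vec d :=
  iterates η g x₁ (fun n => W n ω) (fun n i => ξ n i ω) k

/-- The iterates depend only on the past randomness. -/
lemma measurable_process_past (hg : Measurable (Function.uncurry g)) (η : ℝ) (x₁ : Vec d)
    (k : ℕ) :
    Measurable[⨆ n ∈ Set.Iio k, MeasurableSpace.comap (fun ω => (W n ω, fun i => ξ n i ω))
      inferInstance] (process η g x₁ W ξ k) := by
  induction k with
  | zero => exact @measurable_const _ _ _ _ _
  | succ k ih =>
    set 𝓕 : MeasurableSpace Ω := ⨆ n ∈ Set.Iio (k + 1),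
      MeasurableSpace.comap (fun ω => (W n ω, fun i => ξ n i ω)) inferInstance
    have h1 : Measurable[𝓕] (process η g x₁ W ξ k) :=
      ih.mono (biSup_mono fun n hn => Nat.lt_succ_of_lt hn) le_rfl
    have h2 : Measurable[𝓕] fun ω => (W k ω, fun i => ξ k i ω) :=
      (comap_measurable _).mono
        (le_biSup (fun n => MeasurableSpace.comap (fun ω => (W n ω, fun i => ξ n i ω))
          inferInstance) (Set.mem_Iio.mpr (Nat.lt_succ_self k))) le_rfl
    exact measurable_step hg η h1 h2.fst h2.snd

variable [MeasurableSpace Ω] {P : Measure Ω}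

lemma measurable_process (hs : IsSampling P ν D W ξ) (hg : Measurable (Function.uncurry g))
    (η : ℝ) (x₁ : Vec d) (k : ℕ) : Measurable (process η g x₁ W ξ k) := by
  induction k with
  | zero => exact measurable_const
  | succ k ih =>
    exact measurable_step hg η ih (hs.measurable_mixing k)
      (measurable_pi_lambda _ fun i => hs.measurable_batch k i)

lemma IsSampling.measurable_data (hs : IsSampling P ν D W ξ) (k : ℕ) :
    Measurable fun ω => (W k ω, fun i => ξ k i ω) :=
  (hs.measurable_mixing k).prodMk (measurable_pi_lambda _ fun i => hs.measurable_batch k i)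

lemma IsSampling.indepFun_process (hs : IsSampling P ν D W ξ)
    (hg : Measurable (Function.uncurry g)) (η : ℝ) (x₁ : Vec d) (k : ℕ) :
    IndepFun (process η g x₁ W ξ k) (fun ω => (W k ω, fun i => ξ k i ω)) P := by
  -- The σ-algebras generated by the rounds before `k` and by round `k` are independent.
  have h := indep_iSup_of_disjoint (fun n => (hs.measurable_data n).comap_le)
    hs.indep_iterations (S := Set.Iio k) (T := {k}) (by simp)
  rw [iSup_singleton] at h
  rw [IndepFun_iff_Indep]
  exact indep_of_indep_of_le_left h (measurable_process_past hg η x₁ k).comap_le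

variable [IsProbabilityMeasure P]

lemma IsSampling.map_data (hs : IsSampling P ν D W ξ) (k : ℕ) :
    P.map (fun ω => (W k ω, fun i => ξ k i ω)) = ν.prod (Measure.pi D) := by
  have hb : Measurable fun ω i => ξ k i ω :=
    measurable_pi_lambda _ fun i => hs.measurable_batch k i
  have h1 := (indepFun_iff_map_prod_eq_prod_map_map (hs.measurable_mixing k).aemeasurable
    hb.aemeasurable).mp (hs.indep_mixing_batch k)
  have h2 := (iIndepFun_iff_map_fun_eq_pi_map
    (fun i => (hs.measurable_batch k i).aemeasurable)).mp (hs.indep_agents k)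
  rw [h1, h2, hs.law_mixing]
  simp only [hs.law_batch]

lemma IsSampling.map_process_data (hs : IsSampling P ν D W ξ)
    (hg : Measurable (Function.uncurry g)) (η : ℝ) (x₁ : Vec d) (k : ℕ) :
    P.map (fun ω => (process η g x₁ W ξ k ω, (W k ω, fun i => ξ k i ω)))
      = (P.map (process η g x₁ W ξ k)).prod (ν.prod (Measure.pi D)) := by
  rw [(indepFun_iff_map_prod_eq_prod_map_map (measurable_process hs hg η x₁ k).aemeasurable
    (hs.measurable_data k).aemeasurable).mp (hs.indepFun_process hg η x₁ k), hs.map_data]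

/-- All iterates have finite second moments. -/
lemma IsModel.integrable_meanSq_process [NeZero m] (h : IsModel F g D l σ ζ M₁ M₂ ν)
    (hs : IsSampling P ν D W ξ) (η : ℝ) (x₁ : Vec d) (k : ℕ) :
    Integrable (fun ω => meanSq (process η g x₁ W ξ k ω)) P := by
  have := h.prob
  have := h.probMixing
  have hg := h.stochasticGradient.measurable
  induction k with
  | zero => exact integrable_const (meanSq fun _ : Fin m => x₁)
  | succ k ih =>
    have hX := measurable_process hs hg η x₁ k
    have := Measure.isProbabilityMeasure_map (μ := P) hX.aemeasurable
    have hmeas : Measurable fun z : (Fin m → Vec d) × (Mat m × (Fin m → Ξ)) =>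
        meanSq (step η g z.1 z.2.1 z.2.2) :=
      continuous_meanSq.measurable.comp (measurable_step_uncurried hg η)
    obtain ⟨A, hA⟩ := h.exists_integral_meanSq_step_le η
    have key : Integrable (fun z : (Fin m → Vec d) × (Mat m × (Fin m → Ξ)) =>
        meanSq (step η g z.1 z.2.1 z.2.2))
        ((P.map (process η g x₁ W ξ k)).prod (ν.prod (Measure.pi D))) := by
      rw [integrable_prod_iff hmeas.aestronglyMeasurable]
      -- `A` does not depend on the point, so the inner integral is dominated by the second moment
      -- at step `k`, integrable by induction.
      refine ⟨ae_of_all _ fun x => (hA x).1, ?_⟩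
      have hi : Integrable (meanSq : (Fin m → Vec d) → ℝ) (P.map (process η g x₁ W ξ k)) :=
        (integrable_map_measure continuous_meanSq.aestronglyMeasurable hX.aemeasurable).mpr ih
      refine (((integrable_const 1).add hi).const_mul A).mono'
        hmeas.aestronglyMeasurable.norm.integral_prod_right' (ae_of_all _ fun x => ?_)
      rw [Real.norm_of_nonneg (integral_nonneg fun _ => norm_nonneg _)]
      simp only [Real.norm_of_nonneg (meanSq_nonneg _)]
      exact (hA x).2
    rw [← hs.map_process_data hg η x₁ k] at key
    exact (integrable_map_measure hmeas.aestronglyMeasurable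
      (hX.prodMk (hs.measurable_data k)).aemeasurable).mp key

lemma IsModel.integrable_comp_process [NeZero m] (h : IsModel F g D l σ ζ M₁ M₂ ν)
    (hs : IsSampling P ν D W ξ) (η : ℝ) (x₁ : Vec d) (k : ℕ) {f : (Fin m → Vec d) → ℝ}
    (hf : QuadraticGrowth f) : Integrable (fun ω => f (process η g x₁ W ξ k ω)) P :=
  hf.integrable (measurable_process hs h.stochasticGradient.measurable η x₁ k)
    (h.integrable_meanSq_process hs η x₁ k)

/-- A bound for one iteration from every fixed point carries over to the expectations. -/
lemma IsModel.integral_process_succ_le [NeZero m] (h : IsModel F g D l σ ζ M₁ M₂ ν)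
    (hs : IsSampling P ν D W ξ) (η : ℝ) (x₁ : Vec d) (k : ℕ) {f f' : (Fin m → Vec d) → ℝ}
    (hf : QuadraticGrowth f)
    (hi' : Integrable (fun ω => f' (process η g x₁ W ξ k ω)) P) (hm' : Measurable f')
    (hle : ∀ x, ∫ y, f (step η g x y.1 y.2) ∂(ν.prod (Measure.pi D)) ≤ f' x) :
    ∫ ω, f (process η g x₁ W ξ (k + 1) ω) ∂P ≤ ∫ ω, f' (process η g x₁ W ξ k ω) ∂P := by
  have := h.prob
  have := h.probMixing
  have hg := h.stochasticGradient.measurable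
  have hX := measurable_process hs hg η x₁ k
  have := Measure.isProbabilityMeasure_map (μ := P) hX.aemeasurable
  have hXY := hX.prodMk (hs.measurable_data k)
  have hmeas : Measurable fun z : (Fin m → Vec d) × (Mat m × (Fin m → Ξ)) =>
      f (step η g z.1 z.2.1 z.2.2) := hf.1.comp (measurable_step_uncurried hg η)
  have h1 : ∫ ω, f (process η g x₁ W ξ (k + 1) ω) ∂P
      = ∫ z, f (step η g z.1 z.2.1 z.2.2)
        ∂((P.map (process η g x₁ W ξ k)).prod (ν.prod (Measure.pi D))) := by
    rw [← hs.map_process_data hg η x₁ k,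
      integral_map hXY.aemeasurable hmeas.aestronglyMeasurable]
    rfl
  have hi : Integrable (fun z : (Fin m → Vec d) × (Mat m × (Fin m → Ξ)) =>
      f (step η g z.1 z.2.1 z.2.2))
      ((P.map (process η g x₁ W ξ k)).prod (ν.prod (Measure.pi D))) := by
    rw [← hs.map_process_data hg η x₁ k,
      integrable_map_measure hmeas.aestronglyMeasurable hXY.aemeasurable]
    exact h.integrable_comp_process hs η x₁ (k + 1) hf
  -- Under the product law of iterate and fresh data, Fubini exposes the inner integral bounded by
  -- `hle`.
  rw [h1, integral_prod _ hi, ← integral_map hX.aemeasurable hm'.aestronglyMeasurable]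
  refine integral_mono hi.integral_prod_left ?_ hle
  exact (integrable_map_measure hm'.aestronglyMeasurable hX.aemeasurable).mpr hi'

/-- One step of the descent of the objective, in terms of the step size `η`. -/
lemma IsModel.globalObj_step_le [NeZero m] (h : IsModel F g D l σ ζ M₁ M₂ ν) {Finf : ℝ}
    (hinf : ∀ x, Finf ≤ globalObj F x) {η : ℝ} (hη : 0 ≤ η) (h1 : l * η ≤ 1)
    (h2 : 4 * (l * η * M₁) ≤ 1) (x : Fin m → Vec d) :
    ∫ y, globalObj F (average (step η g x y.1 y.2)) ∂(ν.prod (Measure.pi D))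
      ≤ globalObj F (average x) - η / 4 * ‖gradient (globalObj F) (average x)‖ ^ 2
        + η * l ^ 2 * dispersion x + l * η ^ 2 * σ ^ 2 / (2 * m) := by
  refine (h.integral_globalObj_step_le hinf η x).trans ?_
  set a := gradient (globalObj F) (average x)
  set b := average fun i => gradient (F i) (x i)
  have hl := h.l_nonneg
  have hM := h.M₁_nonneg
  have hm : (1 : ℝ) ≤ m := by exact_mod_cast NeZero.one_le
  have hV := dispersion_nonneg x
  have hab : ‖a - b‖ ^ 2 ≤ l ^ 2 * dispersion x := by
    have h3 := h.smooth.norm_average_gradient_sub_le x fun _ => average x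
    rw [← h.smooth.gradient_globalObj, norm_sub_rev] at h3
    exact h3
  rw [norm_sub_sq_real] at hab
  have hn := h.noiseLevel_noise_le x
  -- With l·η ≤ 1, the terms -η⟨a, b⟩ + (η/2)‖b‖² complete to (η/2)(‖a - b‖² - ‖a‖²). The noise then
  -- costs half of the gain (η/2)‖a‖².
  have e1 : l / 2 * (η ^ 2 * ‖b‖ ^ 2) ≤ η / 2 * ‖b‖ ^ 2 := by
    have := mul_le_mul_of_nonneg_right h1 (by positivity : 0 ≤ η / 2 * ‖b‖ ^ 2)
    linarith
  have e2 : η / 2 * (‖a‖ ^ 2 - 2 * inner ℝ a b + ‖b‖ ^ 2) ≤ η / 2 * (l ^ 2 * dispersion x) :=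
    mul_le_mul_of_nonneg_left hab (by positivity)
  have e3 : l / 2 * (η ^ 2 * (1 / (m : ℝ) * noiseLevel D (noise F g x)))
      ≤ l * η ^ 2 * σ ^ 2 / (2 * m) + η / 4 * (‖a‖ ^ 2 + l ^ 2 * dispersion x) := by
    have h3 : l / 2 * (η ^ 2 * (1 / (m : ℝ) * noiseLevel D (noise F g x)))
        ≤ l / 2 * (η ^ 2 * (1 / (m : ℝ)
          * (σ ^ 2 + 2 * M₁ * (‖a‖ ^ 2 + l ^ 2 * dispersion x)))) := by gcongr
    have h4 : l * η ^ 2 * M₁ * (‖a‖ ^ 2 + l ^ 2 * dispersion x) * (1 / (m : ℝ))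
        ≤ l * η ^ 2 * M₁ * (‖a‖ ^ 2 + l ^ 2 * dispersion x) :=
      mul_le_of_le_one_right (by positivity) (by
        rw [one_div]; exact inv_le_one_of_one_le₀ hm)
    have h5 := mul_le_mul_of_nonneg_right h2
      (by positivity : 0 ≤ η / 4 * (‖a‖ ^ 2 + l ^ 2 * dispersion x))
    have h6 : l / 2 * (η ^ 2 * (1 / (m : ℝ)
          * (σ ^ 2 + 2 * M₁ * (‖a‖ ^ 2 + l ^ 2 * dispersion x))))
        = l * η ^ 2 * σ ^ 2 / (2 * m)
          + l * η ^ 2 * M₁ * (‖a‖ ^ 2 + l ^ 2 * dispersion x) * (1 / (m : ℝ)) := by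
      field_simp
    linarith
  have e4 : 0 ≤ η * (l ^ 2 * dispersion x) := by positivity
  linarith

/-- One step of the contraction of the consensus distance, in terms of the spectral gap `p`. -/
lemma IsModel.dispersion_step_le [NeZero m] (h : IsModel F g D l σ ζ M₁ M₂ ν) {η p : ℝ}
    (hp : 0 < p) (hpν : p = 1 - meanSqDist ν) (h1 : 48 * (l * η) ^ 2 ≤ p ^ 2)
    (h2 : 16 * M₁ * (l * η) ^ 2 ≤ p) (x : Fin m → Vec d) :
    ∫ y, dispersion (step η g x y.1 y.2) ∂(ν.prod (Measure.pi D))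
      ≤ (1 - p / 4) * dispersion x + η ^ 2 * (6 / p * ζ ^ 2 + σ ^ 2)
        + η ^ 2 * (6 / p * M₂ + 2 * M₁) * ‖gradient (globalObj F) (average x)‖ ^ 2 := by
  -- With τ = p/2 the contraction is (1 + p/2)(1 - p) ≤ 1 - p/2; gradient drift and noise each give
  -- back at most p/8.
  refine (h.integral_dispersion_step_le η (half_pos hp) x).trans ?_
  set e := ‖gradient (globalObj F) (average x)‖ ^ 2
  have hp1 : p ≤ 1 := by linarith [meanSqDist_nonneg ν]
  have hq : meanSqDist ν = 1 - p := by linarith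
  have hV := dispersion_nonneg x
  have e1 : (1 + p / 2) * (meanSqDist ν * dispersion x) ≤ (1 - p / 2) * dispersion x := by
    rw [hq]; nlinarith [mul_nonneg (sq_nonneg p) hV]
  have hc : 1 + 1 / (p / 2) ≤ 3 / p := by
    rw [div_div_eq_mul_div, one_mul, ← sub_nonneg]
    have : 3 / p - (1 + 2 / p) = (1 - p) / p := by field_simp; ring
    rw [this]
    exact div_nonneg (by linarith) hp.le
  have e2 : (1 + 1 / (p / 2)) * (η ^ 2 * meanSq fun i => gradient (F i) (x i))
      ≤ 3 / p * (η ^ 2 * (2 * (ζ ^ 2 + M₂ * e) + 2 * (l ^ 2 * dispersion x))) := by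
    have := meanSq_nonneg fun i => gradient (F i) (x i)
    gcongr
    exact h.meanSq_gradient_le x
  have e3 := mul_le_mul_of_nonneg_left (h.noiseLevel_noise_le x) (sq_nonneg η)
  have e4 : 6 / p * (l * η) ^ 2 * dispersion x ≤ p / 8 * dispersion x := by
    gcongr
    rw [div_mul_eq_mul_div, div_le_iff₀ hp]
    linarith
  have e5 := mul_le_mul_of_nonneg_right h2 (by positivity : 0 ≤ 1 / 8 * dispersion x)
  have e6 : 3 / p * (η ^ 2 * (2 * (ζ ^ 2 + M₂ * e) + 2 * (l ^ 2 * dispersion x)))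
      = η ^ 2 * (6 / p * ζ ^ 2) + η ^ 2 * (6 / p * M₂) * e
        + 6 / p * (l * η) ^ 2 * dispersion x := by ring
  linarith

end Iterates

end DPSGD

namespace DPSGD

/-! ### Summing the recursions and choosing the step size. -/

section Convergence

lemma sum_le_of_contraction {v e : ℕ → ℝ} {p a b : ℝ} (h0 : v 0 = 0) (hnn : ∀ k, 0 ≤ v k)
    (h : ∀ k, v (k + 1) ≤ (1 - p) * v k + a + b * e k) (N : ℕ) :
    p * ∑ k ∈ Finset.range N, v k ≤ N * a + b * ∑ k ∈ Finset.range N, e k := by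
  -- Keeping the boundary term `v N` makes the induction telescope.
  have key : p * ∑ k ∈ Finset.range N, v k + v N
      ≤ N * a + b * ∑ k ∈ Finset.range N, e k := by
    induction N with
    | zero => simp [h0]
    | succ N ih =>
      rw [Finset.sum_range_succ, Finset.sum_range_succ]
      push_cast
      linarith [h N]
  linarith [hnn N]

lemma sum_le_of_descent {f v e : ℕ → ℝ} {c q r : ℝ}
    (h : ∀ k, f (k + 1) ≤ f k - c * e k + q * v k + r) (N : ℕ) :
    c * ∑ k ∈ Finset.range N, e k ≤ f 0 - f N + q * ∑ k ∈ Finset.range N, v k + N * r := by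
  induction N with
  | zero => simp
  | succ N ih =>
    rw [Finset.sum_range_succ, Finset.sum_range_succ]
    push_cast
    linarith [h N]

/-- The inverse step size of the analysis, up to a factor depending on `M₁`. -/
noncomputable def inverseStep (σ ζ M₁ M₂ : ℝ) (m : ℕ) (ε p : ℝ) : ℝ :=
  σ ^ 2 / (m * ε) + (ζ * √(M₁ + 1) + σ * √p) / (p * √ε) + √((M₂ + 1) * (M₁ + 1)) / p

/-- Shows that `K` is a multiple of the inverse step size over ε, as a bound of type 8Δ/(η·N) ≤ ε/2
requires. -/
lemma K_eq {C l Δ σ ζ M₁ M₂ : ℝ} {m : ℕ} {ε p : ℝ} (hε : 0 < ε) :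
    K C l Δ σ ζ M₁ M₂ m ε p 1 = l * Δ * C * (inverseStep σ ζ M₁ M₂ m ε p / ε) := by
  have h : ε ^ (3 / 2 : ℝ) = √ε * ε := by
    rw [Real.sqrt_eq_rpow, show (3 / 2 : ℝ) = 1 / 2 + 1 by norm_num, Real.rpow_add hε,
      Real.rpow_one]
  have h0 : √ε ≠ 0 := (Real.sqrt_pos.mpr hε).ne'
  rw [K, h, inverseStep]
  simp only [mul_one, one_mul, add_div, div_div]
  ring

/-- The conditions on `θ`, which is `l` times the step size, that the analysis needs. -/
lemma step_conditions {σ ζ M₁ M₂ : ℝ} {m : ℕ} {ε p θ : ℝ} (hm : 0 < m) (hσ : 0 ≤ σ)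
    (hζ : 0 ≤ ζ) (hM₁ : 0 ≤ M₁) (hM₂ : 0 ≤ M₂) (hε : 0 < ε) (hp : 0 < p) (hp1 : p ≤ 1)
    (hθ : 0 < θ) (h : θ * (40 * (M₁ + 1) * inverseStep σ ζ M₁ M₂ m ε p) = 1) :
    θ ≤ 1 ∧ 4 * (θ * M₁) ≤ 1 ∧ 48 * θ ^ 2 ≤ p ^ 2 ∧ 16 * M₁ * θ ^ 2 ≤ p ∧
      32 * θ ^ 2 * (6 / p * M₂ + 2 * M₁) ≤ p ∧ 32 * θ ^ 2 * (6 / p * ζ ^ 2 + σ ^ 2) / p ≤ ε / 4 ∧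
      4 * θ * σ ^ 2 / m ≤ ε / 8 := by
  have hm' : (0 : ℝ) < m := Nat.cast_pos.mpr hm
  have hsε : 0 < √ε := Real.sqrt_pos.mpr hε
  have hsp : 0 < √p := Real.sqrt_pos.mpr hp
  have hs1 : 1 ≤ √(M₁ + 1) := Real.one_le_sqrt.mpr (by linarith)
  set R := √((M₂ + 1) * (M₁ + 1))
  have hprod : 1 ≤ (M₂ + 1) * (M₁ + 1) := by nlinarith [mul_nonneg hM₁ hM₂]
  have hR1 : 1 ≤ R := Real.one_le_sqrt.mpr hprod
  have hR2 : R ^ 2 = (M₂ + 1) * (M₁ + 1) := Real.sq_sqrt (by linarith)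
  have t1 : 0 ≤ σ ^ 2 / (m * ε) := by positivity
  have t2 : 0 ≤ ζ * √(M₁ + 1) / (p * √ε) := by positivity
  have t3 : 0 ≤ σ * √p / (p * √ε) := by positivity
  have t4 : 0 ≤ R / p := by positivity
  have hT : inverseStep σ ζ M₁ M₂ m ε p = σ ^ 2 / (m * ε) + (ζ * √(M₁ + 1) / (p * √ε)
      + σ * √p / (p * √ε)) + R / p := by rw [inverseStep, add_div]
  -- All summands are nonnegative, so each one separately limits `θ`: `b1` to `b4` are these limits.
  -- The factor 40 leaves slack; the last conclusion needs it most, through 4/40 ≤ 1/8.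
  have bound : ∀ u, u ≤ inverseStep σ ζ M₁ M₂ m ε p → 40 * (θ * (M₁ + 1)) * u ≤ 1 := fun u hu => by
    have := mul_le_mul_of_nonneg_left hu (by positivity : 0 ≤ 40 * (θ * (M₁ + 1)))
    linarith [h]
  have hθM : θ ≤ θ * (M₁ + 1) := le_mul_of_one_le_right hθ.le (by linarith)
  have b4 : 40 * (θ * (M₁ + 1)) * R ≤ p := by
    have := bound (R / p) (by linarith)
    rwa [← mul_div_assoc, div_le_one hp] at this
  have b4' : 40 * (θ * (M₁ + 1)) ≤ p :=
    (le_mul_of_one_le_right (by positivity) hR1).trans b4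
  have b3 : 40 * θ * (σ * √p) ≤ p * √ε := by
    have h1 := bound (σ * √p / (p * √ε)) (by linarith)
    rw [← mul_div_assoc, div_le_one (by positivity)] at h1
    have h2 := mul_le_mul_of_nonneg_right hθM (by positivity : 0 ≤ 40 * (σ * √p))
    linarith
  have b2 : 40 * θ * ζ ≤ p * √ε := by
    have h1 := bound (ζ * √(M₁ + 1) / (p * √ε)) (by linarith)
    rw [← mul_div_assoc, div_le_one (by positivity)] at h1
    have h2 := mul_le_mul_of_nonneg_right hθM (by positivity : 0 ≤ 40 * ζ)
    have h3 : 40 * (θ * (M₁ + 1)) * ζ ≤ 40 * (θ * (M₁ + 1)) * (ζ * √(M₁ + 1)) :=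
      mul_le_mul_of_nonneg_left (le_mul_of_one_le_right hζ hs1) (by positivity)
    linarith
  have b1 : 40 * θ * σ ^ 2 ≤ m * ε := by
    have h1 := bound (σ ^ 2 / (m * ε)) (by linarith)
    rw [← mul_div_assoc, div_le_one (by positivity)] at h1
    have h2 := mul_le_mul_of_nonneg_right hθM (by positivity : 0 ≤ 40 * σ ^ 2)
    linarith
  have c1 : 40 * θ ≤ p := by linarith
  have c2 : (40 * θ) ^ 2 ≤ p ^ 2 := pow_le_pow_left₀ (by positivity) c1 2
  have c3 : (40 * (θ * (M₁ + 1)) * R) ^ 2 ≤ p ^ 2 := pow_le_pow_left₀ (by positivity) b4 2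
  have c4 : (40 * θ * ζ) ^ 2 ≤ p ^ 2 * ε := by
    have := pow_le_pow_left₀ (by positivity) b2 2
    rwa [mul_pow p, Real.sq_sqrt hε.le] at this
  have c5 : 1600 * θ ^ 2 * σ ^ 2 ≤ p * ε := by
    have h1 := pow_le_pow_left₀ (by positivity) b3 2
    rw [mul_pow p, Real.sq_sqrt hε.le, mul_pow, mul_pow σ, Real.sq_sqrt hp.le] at h1
    refine le_of_mul_le_mul_right ?_ hp
    linarith
  have hθM₁ : 40 * (θ * M₁) ≤ p := by linarith
  refine ⟨by linarith, by linarith, by linarith [sq_nonneg θ], ?_, ?_, ?_, ?_⟩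
  · have := mul_le_mul_of_nonneg_left (by linarith : θ ≤ 1) (by positivity : 0 ≤ 16 * (θ * M₁))
    linarith
  · have h1 : 32 * θ ^ 2 * (6 / p * M₂ + 2 * M₁)
        = (192 * θ ^ 2 * M₂ + 64 * θ ^ 2 * (M₁ * p)) / p := by field_simp; ring
    rw [h1, div_le_iff₀ hp]
    have h2 : θ ^ 2 * ((M₂ + 1) * (M₁ + 1))
        ≤ θ ^ 2 * ((M₁ + 1) ^ 2 * ((M₂ + 1) * (M₁ + 1))) := by
      refine mul_le_mul_of_nonneg_left (le_mul_of_one_le_left (by positivity) ?_) (by positivity)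
      exact one_le_pow₀ (by linarith)
    have h3 : (40 * (θ * (M₁ + 1)) * R) ^ 2
        = 1600 * (θ ^ 2 * ((M₁ + 1) ^ 2 * ((M₂ + 1) * (M₁ + 1)))) := by
      rw [mul_pow, hR2]; ring
    have h4 : M₁ * p ≤ M₁ := mul_le_of_le_one_right hM₁ hp1
    have h5 : θ ^ 2 * (M₁ * p) ≤ θ ^ 2 * M₁ := mul_le_mul_of_nonneg_left h4 (sq_nonneg θ)
    have h6 : 0 ≤ θ ^ 2 * (M₁ * M₂) := by positivity
    have h7 : θ ^ 2 * ((M₂ + 1) * (M₁ + 1))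
        = θ ^ 2 * (M₁ * M₂) + θ ^ 2 * M₁ + θ ^ 2 * M₂ + θ ^ 2 := by ring
    have h8 := mul_nonneg (sq_nonneg θ) hM₁
    have h9 := mul_nonneg (sq_nonneg θ) hM₂
    rw [h3] at c3
    rw [h7] at h2
    linarith [sq_nonneg θ]
  · have h1 : 32 * θ ^ 2 * (6 / p * ζ ^ 2 + σ ^ 2) / p
        = (192 * θ ^ 2 * ζ ^ 2 + 32 * θ ^ 2 * σ ^ 2 * p) / p ^ 2 := by field_simp; ring
    rw [h1, div_le_iff₀ (by positivity)]
    have h2 := mul_le_mul_of_nonneg_right c5 hp.le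
    have h3 : 0 ≤ ε * p ^ 2 := by positivity
    linarith
  · rw [div_le_iff₀ hm']
    linarith [mul_pos hm' hε]

variable {m d : ℕ} {Ξ Ω : Type*} [MeasurableSpace Ξ] {F : Fin m → Vec d → ℝ}
  {g : Vec d → Ξ → Vec d} {D : Fin m → Measure Ξ} {l σ ζ M₁ M₂ : ℝ} {ν : Measure (Mat m)}
  {W : ℕ → Ω → Mat m} {ξ : ℕ → Fin m → Ω → Ξ} [MeasurableSpace Ω] {P : Measure Ω}
  [IsProbabilityMeasure P]

/-- The sum of the expected squared gradient norms, for a small step size. -/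
lemma IsModel.sum_sqGrad_le [NeZero m] (h : IsModel F g D l σ ζ M₁ M₂ ν)
    (hs : IsSampling P ν D W ξ) (x₁ : Vec d) {Finf η p : ℝ}
    (hinf : ∀ x, Finf ≤ globalObj F x) (hη : 0 < η) (hp : 0 < p) (hpν : p = 1 - meanSqDist ν)
    (h1 : l * η ≤ 1) (h2 : 4 * (l * η * M₁) ≤ 1) (h3 : 48 * (l * η) ^ 2 ≤ p ^ 2)
    (h4 : 16 * M₁ * (l * η) ^ 2 ≤ p) (h5 : 32 * (l * η) ^ 2 * (6 / p * M₂ + 2 * M₁) ≤ p)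
    (N : ℕ) :
    ∑ k ∈ Finset.range N,
        ∫ ω, ‖gradient (globalObj F) (average (process η g x₁ W ξ k ω))‖ ^ 2 ∂P
      ≤ 8 * (globalObj F x₁ - Finf) / η
        + N * (32 * (l * η) ^ 2 * (6 / p * ζ ^ 2 + σ ^ 2) / p + 4 * (l * η) * σ ^ 2 / m) := by
  have hl := h.l_nonneg
  have hM₁ := h.M₁_nonneg
  have hM₂ := h.M₂_nonneg
  set e : ℕ → ℝ := fun k =>
    ∫ ω, ‖gradient (globalObj F) (average (process η g x₁ W ξ k ω))‖ ^ 2 ∂P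
  set v : ℕ → ℝ := fun k => ∫ ω, dispersion (process η g x₁ W ξ k ω) ∂P
  set f : ℕ → ℝ := fun k => ∫ ω, globalObj F (average (process η g x₁ W ξ k ω)) ∂P
  have qe := quadraticGrowth_sqGrad (m := m) hl h.smooth
  have qv := quadraticGrowth_dispersion (m := m) (d := d)
  have qf := quadraticGrowth_globalObj (m := m) hl h.smooth hinf
  have ie := fun k => h.integrable_comp_process hs η x₁ k qe
  have iv := fun k => h.integrable_comp_process hs η x₁ k qv
  have iF := fun k => h.integrable_comp_process hs η x₁ k qf
  have hv0 : v 0 = 0 := by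
    have : ∀ ω, process η g x₁ W ξ 0 ω = fun _ => x₁ := fun _ => rfl
    simp [v, this, dispersion_const]
  have hf0 : f 0 = globalObj F x₁ := by
    have : ∀ ω, process η g x₁ W ξ 0 ω = fun _ => x₁ := fun _ => rfl
    simp [f, this, average_const]
  have hfN : Finf ≤ f N := by
    have := integral_mono (integrable_const Finf) (iF N) fun ω => hinf _
    simpa using this
  have hvstep : ∀ k, v (k + 1) ≤ (1 - p / 4) * v k + η ^ 2 * (6 / p * ζ ^ 2 + σ ^ 2)
      + η ^ 2 * (6 / p * M₂ + 2 * M₁) * e k := fun k => by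
    have i1 := (iv k).const_mul (1 - p / 4)
    have i2 : Integrable (fun _ : Ω => η ^ 2 * (6 / p * ζ ^ 2 + σ ^ 2)) P := integrable_const _
    have i3 := (ie k).const_mul (η ^ 2 * (6 / p * M₂ + 2 * M₁))
    refine (h.integral_process_succ_le hs η x₁ k qv
      (f' := fun x => (1 - p / 4) * dispersion x + η ^ 2 * (6 / p * ζ ^ 2 + σ ^ 2)
        + η ^ 2 * (6 / p * M₂ + 2 * M₁) * ‖gradient (globalObj F) (average x)‖ ^ 2)
      ((i1.add i2).add i3)
      (((qv.1.const_mul _).add_const _).add (qe.1.const_mul _))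
      (h.dispersion_step_le hp hpν h3 h4)).trans (le_of_eq ?_)
    rw [integral_add (f := fun ω => (1 - p / 4) * dispersion (process η g x₁ W ξ k ω)
      + η ^ 2 * (6 / p * ζ ^ 2 + σ ^ 2)) (i1.add i2) i3, integral_add i1 i2,
      integral_const_mul, integral_const, integral_const_mul]
    simp [e, v]
  have hfstep : ∀ k, f (k + 1) ≤ f k - η / 4 * e k + η * l ^ 2 * v k
      + l * η ^ 2 * σ ^ 2 / (2 * m) := fun k => by
    have i1 := (iF k).sub ((ie k).const_mul (η / 4))
    have i2 := (iv k).const_mul (η * l ^ 2)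
    have i3 : Integrable (fun _ : Ω => l * η ^ 2 * σ ^ 2 / (2 * m)) P := integrable_const _
    refine (h.integral_process_succ_le hs η x₁ k qf
      (f' := fun x => globalObj F (average x)
        - η / 4 * ‖gradient (globalObj F) (average x)‖ ^ 2
        + η * l ^ 2 * dispersion x + l * η ^ 2 * σ ^ 2 / (2 * m)) ((i1.add i2).add i3)
      (((qf.1.sub (qe.1.const_mul _)).add (qv.1.const_mul _)).add_const _)
      (h.globalObj_step_le hinf hη.le h1 h2)).trans (le_of_eq ?_)
    rw [integral_add (f := fun ω => globalObj F (average (process η g x₁ W ξ k ω))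
        - η / 4 * ‖gradient (globalObj F) (average (process η g x₁ W ξ k ω))‖ ^ 2
        + η * l ^ 2 * dispersion (process η g x₁ W ξ k ω)) (i1.add i2) i3,
      integral_add (f := fun ω => globalObj F (average (process η g x₁ W ξ k ω))
        - η / 4 * ‖gradient (globalObj F) (average (process η g x₁ W ξ k ω))‖ ^ 2) i1 i2,
      integral_sub (iF k) ((ie k).const_mul (η / 4)), integral_const_mul, integral_const_mul]
    simp [e, v, f]
  have sv := sum_le_of_contraction hv0 (fun k => integral_nonneg fun _ => dispersion_nonneg _)
    hvstep N
  have sf := sum_le_of_descent hfstep N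
  have hE : 0 ≤ ∑ k ∈ Finset.range N, e k :=
    Finset.sum_nonneg fun k _ => integral_nonneg fun _ => sq_nonneg _
  change ∑ k ∈ Finset.range N, e k ≤ _
  set E := ∑ k ∈ Finset.range N, e k
  set V := ∑ k ∈ Finset.range N, v k
  rw [hf0] at sf
  have k1 : η * l ^ 2 * V ≤ 4 * η * l ^ 2 / p * (N * (η ^ 2 * (6 / p * ζ ^ 2 + σ ^ 2))
      + η ^ 2 * (6 / p * M₂ + 2 * M₁) * E) := by
    have := mul_le_mul_of_nonneg_left sv (by positivity : 0 ≤ 4 * η * l ^ 2 / p)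
    refine le_trans (le_of_eq ?_) this
    field_simp
  -- Half of the descent η/4·E pays for the gradient part of the consensus error, leaving η/8·E.
  have k2 : 32 * (l * η) ^ 2 * (6 / p * M₂ + 2 * M₁) / p * (η / 8 * E) ≤ η / 8 * E :=
    mul_le_of_le_one_left (by positivity) ((div_le_one hp).mpr h5)
  have k3 : 4 * η * l ^ 2 / p * (N * (η ^ 2 * (6 / p * ζ ^ 2 + σ ^ 2))
      + η ^ 2 * (6 / p * M₂ + 2 * M₁) * E)
      = η / 8 * (N * (32 * (l * η) ^ 2 * (6 / p * ζ ^ 2 + σ ^ 2) / p))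
        + 32 * (l * η) ^ 2 * (6 / p * M₂ + 2 * M₁) / p * (η / 8 * E) := by ring
  have k4 : N * (l * η ^ 2 * σ ^ 2 / (2 * m)) = η / 8 * (N * (4 * (l * η) * σ ^ 2 / m)) := by
    ring
  have k5 : globalObj F x₁ - Finf = η / 8 * (8 * (globalObj F x₁ - Finf) / η) := by
    field_simp
  refine le_of_mul_le_mul_left ?_ (by positivity : 0 < η / 8)
  rw [mul_add, mul_add (N : ℝ), mul_add (η / 8), ← k5]
  linarith

/-- Convergence of D-PSGD after `K` iterations. -/
theorem IsModel.exists_converges [NeZero m] (h : IsModel F g D l σ ζ M₁ M₂ ν)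
    (hs : IsSampling P ν D W ξ) (x₁ : Vec d) {Finf ε : ℝ}
    (hinf : ∀ x, Finf ≤ globalObj F x) (hσ : 0 ≤ σ) (hζ : 0 ≤ ζ) (hε : 0 < ε)
    (hν : meanSqDist ν < 1) :
    ∃ η : ℝ, 0 < η ∧ ∀ N : ℕ,
      K (640 * (M₁ + 1)) l (globalObj F x₁ - Finf) σ ζ M₁ M₂ m ε (1 - meanSqDist ν) 1 ≤ (N : ℝ) →
      Converges P F g x₁ W ξ η ε N := by
  have hM₁ := h.M₁_nonneg
  have hM₂ := h.M₂_nonneg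
  -- For l = 0 the count is 0 and the step size below is undefined; but then the gradient is
  -- constant, hence zero as the objective is bounded below, and any η works.
  rcases h.l_nonneg.eq_or_lt with hl | hl
  · have hzero : ∀ x, gradient (globalObj F) x = 0 := by
      refine gradient_eq_zero_of_bddBelow h.smooth.differentiable_globalObj ?_ hinf
      rw [hl]
      exact h.smooth.norm_gradient_globalObj_sub_le h.l_nonneg
    refine ⟨1, one_pos, fun N _ => ?_⟩
    simp [Converges, hzero, hε.le]
  set p := 1 - meanSqDist ν with hpν
  have hp : 0 < p := by linarith
  have hp1 : p ≤ 1 := by linarith [meanSqDist_nonneg ν]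
  have hm : (0 : ℝ) < m := Nat.cast_pos.mpr (NeZero.pos m)
  set T := inverseStep σ ζ M₁ M₂ m ε p with hT
  have hTpos : 0 < T := by
    have : 0 < √((M₂ + 1) * (M₁ + 1)) := Real.sqrt_pos.mpr (by positivity)
    rw [hT, inverseStep]
    positivity
  set η := 1 / (l * (40 * (M₁ + 1) * T)) with hηdef
  have hη : 0 < η := by positivity
  have hθ : l * η * (40 * (M₁ + 1) * T) = 1 := by
    rw [hηdef]; field_simp
  obtain ⟨c1, c2, c3, c4, c5, c6, c7⟩ := step_conditions (NeZero.pos m) hσ hζ hM₁ hM₂ hε hp hp1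
    (mul_pos hl hη) hθ
  refine ⟨η, hη, fun N hN => ⟨fun k _ => h.integrable_comp_process hs η x₁ k
    (quadraticGrowth_sqGrad h.l_nonneg h.smooth), ?_⟩⟩
  have hsum := h.sum_sqGrad_le hs x₁ hinf hη hp hpν c1 c2 c3 c4 c5 N
  -- The initial gap uses ε/2; `c6` and `c7` add ε/4 and ε/8. Thus 640 = 2 · 8 · 40.
  have hΔ : 8 * (globalObj F x₁ - Finf) / η ≤ N * (ε / 2) := by
    rw [K_eq hε, ← hT] at hN
    have h1 := mul_le_mul_of_nonneg_right hN (by positivity : 0 ≤ ε / 2)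
    refine le_trans (le_of_eq ?_) h1
    rw [hηdef]
    field_simp
    ring
  rcases N.eq_zero_or_pos with rfl | hNpos
  -- For N = 0 the empty sum makes the average 0.
  · simp [hε.le]
  · have hN' : (0 : ℝ) < N := Nat.cast_pos.mpr hNpos
    rw [one_div, inv_mul_le_iff₀ hN']
    refine hsum.trans ?_
    have h2 := mul_le_mul_of_nonneg_left (add_le_add c6 c7) hN'.le
    have h3 : 0 ≤ N * ε := by positivity
    linarith

end Convergence

end DPSGD

theorem mainTheorem2 (M₁ : ℝ) (hM₁ : 0 ≤ M₁) :
    ∃ C : ℝ, 0 < C ∧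
      ∀ (m d : ℕ) (_ : 0 < m) (Ξ : Type*) [MeasurableSpace Ξ]
        (F : Fin m → DPSGD.Vec d → ℝ) (g : DPSGD.Vec d → Ξ → DPSGD.Vec d)
        (D : Fin m → Measure Ξ) (l σ ζ M₂ Finf ε : ℝ) (x₁ : DPSGD.Vec d)
        (_ : 0 ≤ l) (_ : 0 ≤ σ) (_ : 0 ≤ ζ) (_ : 0 ≤ M₂) (_ : 0 < ε)
        (_ : ∀ i, IsProbabilityMeasure (D i))
        (_ : DPSGD.IsStochasticGradient F g D)
        (_ : DPSGD.Smooth F l)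
        (_ : DPSGD.NoiseBound F g D σ M₁)
        (_ : DPSGD.HeterogeneityBound F ζ M₂)
        (_ : ∀ x, Finf ≤ DPSGD.globalObj F x)
        (ν : Measure (DPSGD.Mat m)) (_ : IsProbabilityMeasure ν)
        (_ : ∀ᵐ w ∂ν, DPSGD.IsMixing w),
        -- convergence of D-PSGD
        (DPSGD.FiniteMeanSqDist ν → DPSGD.meanSqDist ν < 1 →
          ∀ (Ω : Type*) [MeasurableSpace Ω] (P : Measure Ω) (_ : IsProbabilityMeasure P)
            (W : ℕ → Ω → DPSGD.Mat m) (ξ : ℕ → Fin m → Ω → Ξ)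
            (_ : DPSGD.IsSampling P ν D W ξ),
            ∃ η : ℝ, 0 < η ∧
              ∀ N : ℕ,
                DPSGD.K C l (DPSGD.globalObj F x₁ - Finf) σ ζ M₁ M₂ m ε
                  (1 - DPSGD.meanSqDist ν) 1 ≤ (N : ℝ) →
                DPSGD.Converges P F g x₁ W ξ η ε N) ∧
        -- link weights for a given set of activated links
        (∀ (G : SimpleGraph (Fin m)) [DecidableRel G.Adj] (src dst : G.edgeSet → Fin m)
            (_ : DPSGD.IsOrientation src dst) (Ea : Set (Sym2 (Fin m))) (_ : Ea ⊆ G.edgeSet),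
          -- lower bound, conditioned on any event that only links in `Ea` are activated
          (∀ A : Set (DPSGD.Mat m), MeasurableSet A → ν A ≠ 0 →
            (∀ w ∈ A, DPSGD.activatedLinks w ⊆ Ea) →
            DPSGD.FiniteMeanSqDist (ProbabilityTheory.cond ν A) →
            DPSGD.meanSqDist (ProbabilityTheory.cond ν A) < 1 →
            DPSGD.K C l (DPSGD.globalObj F x₁ - Finf) σ ζ M₁ M₂ m ε
                (1 - DPSGD.sdpValue src dst Ea ^ 2) 1
              ≤ DPSGD.K C l (DPSGD.globalObj F x₁ - Finf) σ ζ M₁ M₂ m ε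
                (1 - DPSGD.meanSqDist (ProbabilityTheory.cond ν A)) 1) ∧
          -- the program attains its optimal value
          (∃ α, DPSGD.SDPFeasible src dst Ea α (DPSGD.sdpValue src dst Ea)) ∧
          -- equality for the deterministic mixing matrix given by any optimal link weights
          (∀ α, DPSGD.SDPFeasible src dst Ea α (DPSGD.sdpValue src dst Ea) →
            DPSGD.IsMixing (DPSGD.mixingOf src dst α) ∧
            DPSGD.activatedLinks (DPSGD.mixingOf src dst α) ⊆ Ea ∧
            DPSGD.K C l (DPSGD.globalObj F x₁ - Finf) σ ζ M₁ M₂ m ε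
                (1 - DPSGD.meanSqDist (Measure.dirac (DPSGD.mixingOf src dst α))) 1
              = DPSGD.K C l (DPSGD.globalObj F x₁ - Finf) σ ζ M₁ M₂ m ε
                (1 - DPSGD.sdpValue src dst Ea ^ 2) 1)) := by
  refine ⟨640 * (M₁ + 1), by positivity, ?_⟩
  intro m d hm Ξ _ F g D l σ ζ M₂ Finf ε x₁ hl hσ hζ hM₂ hε hD hg hF hN hH hinf ν hν hmix
  have : NeZero m := ⟨hm.ne'⟩
  refine ⟨fun hfin hlt Ω _ P _ W ξ hs => ?_, fun G _ src dst hor Ea hEa => ⟨?_, ?_, ?_⟩⟩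
  · have h : DPSGD.IsModel F g D l σ ζ M₁ M₂ ν := ⟨hl, hM₁, hM₂, hD, hg, hF, hN, hH, hν, hmix, hfin⟩
    exact h.exists_converges hs x₁ hinf hσ hζ hε hlt
  · intro A hA hA0 hact hfin hlt
    have := cond_isProbabilityMeasure hA0
    -- The conditional law is absolutely continuous with respect to `ν` and concentrated on `A`, so
    -- almost every `w` is mixing and activates only links in `Ea`.
    have hle := DPSGD.sq_le_meanSqDist hfin (DPSGD.sdpValue_nonneg Ea) (by
      filter_upwards [ae_cond_mem hA, cond_absolutelyContinuous.ae_le hmix] with w hwA hw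
      exact hor.sdpValue_le_specNorm hEa hw (hact w hwA))
    exact DPSGD.K_anti (by positivity) hl (sub_nonneg.mpr (hinf x₁)) hσ hζ hε
      (sub_pos.mpr hlt) (sub_le_sub_left hle 1)
  · exact hor.exists_sdpFeasible_sdpValue Ea
  · intro α hα
    refine ⟨hor.isMixing_mixingOf α, hor.activatedLinks_mixingOf_subset hα.2.2, ?_⟩
    rw [DPSGD.meanSqDist_dirac, DPSGD.specNorm_eq_sdpValue hα]
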